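/- Let $n\ge 2$ be an integer. For measurable $f:\mathbb R^n\to\mathbb R$, $1\le p,q<\infty$ and $0<s<1$ put $$\omega(f,t)_p=\Big(\frac{1}{t^n|B^n|}\int_{|h|<t}\|f(\cdot+h)-f\|_{L^p(\mathbb R^n)}^p\,dh\Big)^{1/p}\ (t>0),\qquad \|f\|_{B^s_{p,q}}=\Big(\int_0^\infty t^{-sq}\,\omega(f,t)_p^q\,\frac{dt}{t}\Big)^{1/q}\in[0,\infty],$$ where $B^n$ is the Euclidean unit ball, and let $\dot W^1_n$ be the space of all locally integrable $f:\mathbb R^n\to\mathbb R$ whose weak gradient $\nabla f$ belongs to $L^n(\mathbb R^n)$. Let $n<p_0<\infty$. Then there is a constant $c_{n,p_0}>0$, depending only on $n$ and $p_0$, such that for every $p\in(n,p_0)$ $$\|f\|_{B^{n/p}_{p,n}}\le c_{n,p_0}\Big(1-\frac np\Big)^{-1/n}\|\nabla f\|_{L^n}\qquad\text{for all } f\in\dot W^1_n .$$ This blow-up rate as $p\to n+$ is optimal: there is a constant $c'_{n,p_0}>0$, depending only on $n$ and $p_0$, such that whenever $p\in(n,p_0)$ and $A\ge 0$ satisfy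 $\|f\|_{B^{n/p}_{p,n}}\le A\,\|\nabla f\|_{L^n}$ for all $f\in\dot W^1_n$, then $A\ge c'_{n,p_0}\,(1-n/p)^{-1/n}$. -/

import Mathlib

open MeasureTheory Set
open scoped ENNReal NNReal ContDiff

/-- `g` is the weak (distributional) gradient on `ℝⁿ` of the locally integrable function `f`:
`∫ f ∂ᵥφ = - ∫ ⟨g, v⟩ φ` for every test function `φ ∈ C_c^∞(ℝⁿ)` and every direction `v`.
Such a `g` is unique up to equality almost everywhere. -/
structure IsWeakGradient {n : ℕ} (f : EuclideanSpace ℝ (Fin n) → ℝ)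
    (g : EuclideanSpace ℝ (Fin n) → EuclideanSpace ℝ (Fin n)) : Prop where
  locallyIntegrable_fun : LocallyIntegrable f volume
  locallyIntegrable_grad : LocallyIntegrable g volume
  integral_eq : ∀ φ : EuclideanSpace ℝ (Fin n) → ℝ, ContDiff ℝ ∞ φ → HasCompactSupport φ →
    ∀ v : EuclideanSpace ℝ (Fin n),
      ∫ x, f x * fderiv ℝ φ x v = - ∫ x, inner ℝ (g x) v * φ x

/-- `f` belongs to the homogeneous Sobolev space `Ẇ¹ᵣ(ℝⁿ)` and its weak gradient is `∇f = g`: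
`f` is locally integrable and `∇f ∈ Lʳ` (Euclidean length of the gradient). -/
def IsHomSobolevWithGradient {n : ℕ} (r : ℝ≥0∞) (f : EuclideanSpace ℝ (Fin n) → ℝ)
    (g : EuclideanSpace ℝ (Fin n) → EuclideanSpace ℝ (Fin n)) : Prop :=
  IsWeakGradient f g ∧ MemLp g r volume

/-- The averaged `Lᵖ` modulus of smoothness
`ω(f, t)_p = ( (tⁿ |Bⁿ|)⁻¹ ∫_{|h| < t} ‖f(· + h) - f‖_{Lᵖ}^p dh )^{1/p}`, for `0 < t` and
`1 ≤ p < ∞`, as a number in `[0, ∞]`. -/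
noncomputable def smoothnessModulus {n : ℕ} (f : EuclideanSpace ℝ (Fin n) → ℝ) (p t : ℝ) :
    ℝ≥0∞ :=
  ((ENNReal.ofReal (t ^ n) * volume (Metric.ball (0 : EuclideanSpace ℝ (Fin n)) 1))⁻¹ *
    ∫⁻ h in Metric.ball (0 : EuclideanSpace ℝ (Fin n)) t,
      eLpNorm (fun x => f (x + h) - f x) (ENNReal.ofReal p) volume ^ p) ^ (1 / p)

/-- The (homogeneous) Besov norm
`‖f‖_{B^s_{p,q}} = ( ∫₀^∞ t^{-sq} ω(f, t)_p^q dt/t )^{1/q}`, for `1 ≤ p, q < ∞`, as a number in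
`[0, ∞]`. -/
noncomputable def besovNorm {n : ℕ} (s p q : ℝ) (f : EuclideanSpace ℝ (Fin n) → ℝ) : ℝ≥0∞ :=
  (∫⁻ t in Ioi (0 : ℝ),
    ENNReal.ofReal (t ^ (-(s * q))) * smoothnessModulus f p t ^ q * ENNReal.ofReal (1 / t)) ^
      (1 / q)

/-!
The upper bound is a real interpolation argument with explicit constants. For a `C¹` function `f`
with `G = |∇f|`, comparing `f (x + h)` and `f x` with the values of `f` on a ball of radius `t` about
`x` gives `ω(f, t)_p ≤ c t ‖N G‖_p`, where `N G` (`segmentAverage`) is the average of `G` over the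
points `x + s w` with `s` uniform in `(0, 1)` and `w` uniform in the ball of radius `2 t`
(`smoothnessModulus_le_segmentAverage`). The operator `N` contracts `L^p`, and it maps `L^r` to `L^p`
with norm of order `v ^ (1/p - 1/r)`, where `v` is the measure of that ball and
`1/r = 1/n + 1/(2 P)` for an upper bound `P` of `p` (`lintegral_segmentAverage_rpow_le_of_lt`).

For each `t` the function `G` is cut at the level of its decreasing rearrangement at `v`, that is,
according to whether the measure of `{G ≥ G x}` exceeds `v` (`superlevelRank`). With `α = n/p` and
`v` as the variable of integration, it remains to bound two integrals by `∫ G ^ n`. High values are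
estimated in `L^r` and lead to `∫ v ^ (-n/r) (∫_{rank ≤ v} G ^ r) ^ (n/r) dv`, which is Hardy's
inequality, since `n/r > 1` (`hardy_superlevelRank`); its constant does not depend on `p`. Low values
are estimated in `L^p` and lead to `∫ v ^ (-α) (∫_{rank > v} G ^ p) ^ α dv` with `α < 1`. Here the
dyadic levels of `G` are summed by subadditivity of `y ^ α`, and `∫_0^m v ^ (-α) dv = m ^ (1-α)/(1-α)`
produces the factor `(1 - n/p)⁻¹`, whose `n`-th root is the blow-up rate
(`lintegral_lt_superlevelRank_rpow_le`).

A function with weak gradient in `L^n` is the almost everywhere limit of its mollifications, whose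
gradients have no larger `L^n` norm, and the Besov norm is lower semicontinuous under such limits
(`besovNorm_rpow_le_of_tendsto`).

The rate is attained by every function that is linear and nonconstant near a point, because its
modulus of smoothness is at least of order `t` there, uniformly in `p`, and the integral
`∫_0^{1/2} t ^ (n (1 - n/p)) dt/t` is of order `(1 - n/p)⁻¹` (`exists_le_besovNorm`); a cut-off
linear function serves as test function.
-/

/-! ### Inequalities for lower integrals -/

/-- Jensen's inequality for `y ↦ y ^ p` and a measure of total mass at most `1`. -/
theorem lintegral_rpow_le_lintegral_rpow {α : Type*} [MeasurableSpace α] {ν : Measure α}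
    (hν : ν univ ≤ 1) {p : ℝ} (hp : 1 ≤ p) {F : α → ℝ≥0∞} (hF : AEMeasurable F ν) :
    (∫⁻ a, F a ∂ν) ^ p ≤ ∫⁻ a, F a ^ p ∂ν := by
  rcases hp.eq_or_lt with rfl | hp
  · simp
  have hpq := Real.HolderConjugate.conjExponent hp
  have h := ENNReal.lintegral_mul_le_Lp_mul_Lq ν hpq hF (aemeasurable_const (b := (1 : ℝ≥0∞)))
  simp only [Pi.mul_apply, mul_one, ENNReal.one_rpow, lintegral_const, one_mul] at h
  have hq : (ν univ) ^ (1 / p.conjExponent) ≤ 1 :=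
    ENNReal.rpow_le_one hν (by have := hpq.symm.pos; positivity)
  have h2 : ∫⁻ a, F a ∂ν ≤ (∫⁻ a, F a ^ p ∂ν) ^ (1 / p) :=
    h.trans (mul_le_of_le_one_right' hq)
  have := ENNReal.rpow_le_rpow h2 (by linarith : 0 ≤ p)
  rwa [← ENNReal.rpow_mul, one_div_mul_cancel (by linarith), ENNReal.rpow_one] at this

theorem ENNReal.tsum_rpow_le_tsum_rpow {ι : Type*} (a : ι → ℝ≥0∞) {θ : ℝ} (h0 : 0 < θ)
    (h1 : θ ≤ 1) : (∑' i, a i) ^ θ ≤ ∑' i, a i ^ θ := by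
  have hfin : ∀ s : Finset ι, (∑ i ∈ s, a i) ^ θ ≤ ∑ i ∈ s, a i ^ θ := by
    classical
    intro s
    induction s using Finset.induction_on with
    | empty => simp [h0]
    | insert i s hi ih =>
      rw [Finset.sum_insert hi, Finset.sum_insert hi]
      exact (ENNReal.rpow_add_le_add_rpow _ _ h0.le h1).trans (by gcongr)
  have h := (ENNReal.continuous_rpow_const (y := θ)).tendsto (∑' i, a i)
  refine le_of_tendsto (h.comp ENNReal.summable.hasSum) (Filter.Eventually.of_forall fun s => ?_)
  exact (hfin s).trans (ENNReal.sum_le_tsum s)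

theorem lintegral_Ioo_zero_rpow {a c : ℝ} (ha : 0 < a) (hc : 0 ≤ c) :
    ∫⁻ v in Ioo (0 : ℝ) c, ENNReal.ofReal (v ^ (a - 1)) = ENNReal.ofReal (c ^ a / a) := by
  have hint : IntegrableOn (fun v : ℝ => v ^ (a - 1)) (Ioo 0 c) := by
    have := (intervalIntegral.intervalIntegrable_rpow' (a := 0) (b := c) (r := a - 1) (by linarith))
    exact ((intervalIntegrable_iff_integrableOn_Ioc_of_le hc).1 this).mono_set Ioo_subset_Ioc_self
  rw [← ofReal_integral_eq_lintegral_ofReal hint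
    ((ae_restrict_iff' measurableSet_Ioo).2 (ae_of_all _ fun v hv => Real.rpow_nonneg hv.1.le _)),
    ← integral_Ioc_eq_integral_Ioo, ← intervalIntegral.integral_of_le hc,
    integral_rpow (Or.inl (by linarith))]
  simp [ha.ne']

theorem lintegral_Ioi_rpow_neg {a c : ℝ} (ha : 0 < a) (hc : 0 < c) :
    ∫⁻ v in Ioi c, ENNReal.ofReal (v ^ (-1 - a)) = ENNReal.ofReal (c ^ (-a) / a) := by
  have hint : IntegrableOn (fun v : ℝ => v ^ (-1 - a)) (Ioi c) :=
    integrableOn_Ioi_rpow_of_lt (by linarith) hc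
  rw [← ofReal_integral_eq_lintegral_ofReal hint
    ((ae_restrict_iff' measurableSet_Ioi).2 (ae_of_all _ fun v hv =>
      Real.rpow_nonneg (hc.trans hv).le _)), integral_Ioi_rpow_of_lt (by linarith) hc]
  congr 1
  have : -1 - a + 1 = -a := by ring
  rw [this, neg_div_neg_eq]

/-- The integral `∫_V^∞ v ^ (-1 - a) dv`, with the lower limit `V ∈ (0, ∞]` encoded by an indicator so
that it can be exchanged with an integral in a variable on which `V` depends. -/
theorem lintegral_indicator_le_ofReal_rpow {a : ℝ} (ha : 0 < a) {V : ℝ≥0∞} (hV : V ≠ 0) :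
    ∫⁻ v in Ioi (0 : ℝ), {v : ℝ | V ≤ ENNReal.ofReal v}.indicator
      (fun v => ENNReal.ofReal (v ^ (-1 - a))) v = ENNReal.ofReal (1 / a) * V ^ (-a) := by
  rcases eq_or_ne V ∞ with rfl | hV'
  · simp [ha]
  have hc : 0 < V.toReal := ENNReal.toReal_pos hV hV'
  have hset : {v : ℝ | V ≤ ENNReal.ofReal v} = Ici V.toReal := by
    ext v
    simp only [mem_ofPred_eq, mem_Ici]
    constructor
    · intro h
      rcases le_or_gt v 0 with hv | hv
      · rw [ENNReal.ofReal_of_nonpos hv] at h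
        exact absurd (le_zero_iff.1 h) hV
      · exact ENNReal.toReal_le_of_le_ofReal hv.le h
    · intro h
      exact ENNReal.le_ofReal_iff_toReal_le hV' (hc.le.trans h) |>.2 h
  rw [hset, setLIntegral_indicator measurableSet_Ici,
    inter_eq_left.2 (Ici_subset_Ioi.2 hc),
    setLIntegral_congr Ioi_ae_eq_Ici.symm, lintegral_Ioi_rpow_neg ha hc]
  rw [div_eq_mul_one_div, mul_comm, ENNReal.ofReal_mul (by positivity),
    ← ENNReal.ofReal_rpow_of_pos hc, ENNReal.ofReal_toReal hV']

theorem lintegral_indicator_ofReal_lt_rpow {a : ℝ} (ha : 0 < a) (m : ℝ≥0∞) :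
    ∫⁻ v in Ioi (0 : ℝ), {v : ℝ | ENNReal.ofReal v < m}.indicator
      (fun v => ENNReal.ofReal (v ^ (a - 1))) v ≤ ENNReal.ofReal (1 / a) * m ^ a := by
  rcases eq_or_ne m ∞ with rfl | hm
  · rw [ENNReal.top_rpow_of_pos ha, ENNReal.mul_top (by simpa using ha)]
    exact le_top
  have hset : {v : ℝ | ENNReal.ofReal v < m} ∩ Ioi 0 ⊆ Ioo 0 m.toReal := by
    rintro v ⟨h, hv⟩
    exact ⟨hv, (ENNReal.ofReal_lt_iff_lt_toReal (le_of_lt hv) hm).1 h⟩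
  have hmeas : MeasurableSet {v : ℝ | ENNReal.ofReal v < m} :=
    measurableSet_lt ENNReal.measurable_ofReal measurable_const
  rw [setLIntegral_indicator hmeas]
  refine (lintegral_mono_set hset).trans ?_
  rw [lintegral_Ioo_zero_rpow ha ENNReal.toReal_nonneg]
  rw [div_eq_mul_one_div, mul_comm, ENNReal.ofReal_mul (by positivity),
    ← ENNReal.ofReal_rpow_of_nonneg ENNReal.toReal_nonneg ha.le, ENNReal.ofReal_toReal hm]

/-! ### Ranks and Hardy's inequality for the part of high values -/

section SuperlevelRank

variable {X : Type*} [MeasurableSpace X] {μ : Measure X}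

/-- The rank of the value `G x`: the measure of the set where `G` is at least `G x`.
It plays the role of the variable of the decreasing rearrangement of `G`: cutting `G` according to
whether its rank exceeds `v` replaces the cut at the level `G* v`, and is insensitive to ties. -/
noncomputable def superlevelRank (μ : Measure X) (G : X → ℝ≥0∞) (x : X) : ℝ≥0∞ :=
  μ {y | G x ≤ G y}

theorem measurable_superlevelRank {G : X → ℝ≥0∞} (hG : Measurable G) :
    Measurable (superlevelRank μ G) := by
  have : Antitone fun c : ℝ≥0∞ => μ {y | c ≤ G y} :=
    fun c d hcd => measure_mono fun y hy => le_trans hcd hy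
  exact this.measurable.comp hG

/-- The points of rank at most `s` form a union of countably many nested superlevel sets, each of
measure at most `s`. With the rank defined through `G x < G y` instead, this would fail for a `G`
that is constant on a set of large measure. -/
theorem measure_superlevelRank_le {G : X → ℝ≥0∞} (s : ℝ≥0∞) :
    μ {x | superlevelRank μ G x ≤ s} ≤ s := by
  set S : Set ℝ≥0∞ := {c | μ {y | c ≤ G y} ≤ s} with hS
  have hup : ∀ c ∈ S, ∀ d, c ≤ d → d ∈ S := fun c hc d hcd =>
    (measure_mono fun y (hy : d ≤ G y) => le_trans hcd hy).trans hc
  have hsub : {x | superlevelRank μ G x ≤ s} = {x | G x ∈ S} := rfl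
  rw [hsub]
  by_cases hmem : sInf S ∈ S
  · exact (measure_mono fun x (hx : G x ∈ S) => sInf_le hx).trans hmem
  rcases S.eq_empty_or_nonempty with h0 | hne
  · simp [h0]
  obtain ⟨u, hu, -, htend, huS⟩ :=
    (isGLB_sInf S).exists_seq_strictAnti_tendsto_of_notMem hmem hne
  have hcover : {x | G x ∈ S} ⊆ ⋃ k, {x | u k ≤ G x} := by
    intro x hx
    have hlt : sInf S < G x := lt_of_le_of_ne (sInf_le hx) fun h => hmem (h ▸ hx)
    obtain ⟨k, hk⟩ := (htend.eventually (gt_mem_nhds hlt)).exists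
    exact mem_iUnion.2 ⟨k, hk.le⟩
  refine (measure_mono hcover).trans ?_
  rw [Monotone.measure_iUnion]
  · exact iSup_le fun k => huS k
  · intro i j hij x hx
    exact le_trans (hu.antitone hij) hx

/-- The rank-like function `V` is stochastically at least as large as the variable of `(0, ∞)`, so
that `∫_{V ≤ v} V ^ (-1/2)` is at most `∫_0^v s ^ (-1/2) ds`. -/
theorem lintegral_rpow_neg_half_le [SFinite μ] {V : X → ℝ≥0∞} (hV : Measurable V)
    (hVμ : ∀ s, μ {x | V x ≤ s} ≤ s) {v : ℝ} (hv : 0 < v) :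
    ∫⁻ x in {x | V x ≤ ENNReal.ofReal v}, V x ^ (-(1 / 2 : ℝ)) ∂μ ≤
      ENNReal.ofReal (2 * v ^ (1 / 2 : ℝ)) := by
  set A := {x | V x ≤ ENNReal.ofReal v} with hA
  have hAm : MeasurableSet A := measurableSet_le hV measurable_const
  have hV0 : ∀ᵐ x ∂(μ.restrict A), V x ≠ 0 := by
    refine ae_restrict_of_ae (ae_iff.2 ?_)
    simpa using hVμ 0
  have h1 : ∀ᵐ x ∂(μ.restrict A), V x ^ (-(1 / 2 : ℝ)) = ENNReal.ofReal (1 / 2) *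
      ∫⁻ s in Ioi (0 : ℝ), {s : ℝ | V x ≤ ENNReal.ofReal s}.indicator
      (fun s => ENNReal.ofReal (s ^ (-1 - (1 / 2 : ℝ)))) s := by
    filter_upwards [hV0] with x hx
    rw [lintegral_indicator_le_ofReal_rpow (by norm_num) hx, ← mul_assoc,
      ← ENNReal.ofReal_mul (by norm_num)]
    norm_num
  have hjm : Measurable (Function.uncurry fun (x : X) (s : ℝ) =>
      {s : ℝ | V x ≤ ENNReal.ofReal s}.indicator
      (fun s => ENNReal.ofReal (s ^ (-1 - (1 / 2 : ℝ)))) s) := by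
    have : MeasurableSet {q : X × ℝ | V q.1 ≤ ENNReal.ofReal q.2} :=
      measurableSet_le (hV.comp measurable_fst) (ENNReal.measurable_ofReal.comp measurable_snd)
    exact Measurable.indicator (f := fun q : X × ℝ => ENNReal.ofReal (q.2 ^ (-1 - (1 / 2 : ℝ))))
      (by fun_prop) this
  rw [lintegral_congr_ae h1, lintegral_const_mul' _ _ ENNReal.ofReal_ne_top,
    lintegral_lintegral_swap hjm.aemeasurable]
  -- after Tonelli only the bound `μ {V ≤ min s v} ≤ min s v` is used
  have h2 : ∀ s ∈ Ioi (0 : ℝ), ∫⁻ x in A, {s : ℝ | V x ≤ ENNReal.ofReal s}.indicator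
      (fun s => ENNReal.ofReal (s ^ (-1 - (1 / 2 : ℝ)))) s ∂μ ≤
      (Ioo 0 v).indicator (fun s => ENNReal.ofReal (s ^ ((1 / 2 : ℝ) - 1))) s +
      ENNReal.ofReal v * (Ici v).indicator
        (fun s => ENNReal.ofReal (s ^ (-1 - (1 / 2 : ℝ)))) s := by
    intro s hs
    have hs' : (0 : ℝ) < s := hs
    have e : ∀ x, {s : ℝ | V x ≤ ENNReal.ofReal s}.indicator
        (fun s => ENNReal.ofReal (s ^ (-1 - (1 / 2 : ℝ)))) s =
        {x | V x ≤ ENNReal.ofReal s}.indicator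
          (fun _ => ENNReal.ofReal (s ^ (-1 - (1 / 2 : ℝ)))) x := fun x => rfl
    simp_rw [e]
    have hm : MeasurableSet {x | V x ≤ ENNReal.ofReal s} := measurableSet_le hV measurable_const
    rw [lintegral_indicator_const hm, Measure.restrict_apply hm]
    rcases lt_or_ge s v with h | h
    · rw [indicator_of_mem (show s ∈ Ioo 0 v from ⟨hs, h⟩), indicator_of_notMem (by simpa using h),
        mul_zero, add_zero]
      calc _ ≤ ENNReal.ofReal (s ^ (-1 - (1 / 2 : ℝ))) * ENNReal.ofReal s := by
            gcongr
            exact (measure_mono inter_subset_left).trans (hVμ _)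
        _ = _ := by
            rw [← ENNReal.ofReal_mul (by positivity), ← Real.rpow_add_one hs'.ne']
            norm_num
    · rw [indicator_of_notMem (by simp [h]), indicator_of_mem (by simpa using h), zero_add,
        mul_comm]
      gcongr
      exact (measure_mono inter_subset_right).trans (hVμ _)
  have hmI : Measurable fun s : ℝ =>
      (Ioo 0 v).indicator (fun s => ENNReal.ofReal (s ^ ((1 / 2 : ℝ) - 1))) s :=
    Measurable.indicator (by fun_prop) measurableSet_Ioo
  calc _ ≤ ENNReal.ofReal (1 / 2) * ∫⁻ s in Ioi (0 : ℝ),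
        ((Ioo 0 v).indicator (fun s => ENNReal.ofReal (s ^ ((1 / 2 : ℝ) - 1))) s +
        ENNReal.ofReal v * (Ici v).indicator
        (fun s => ENNReal.ofReal (s ^ (-1 - (1 / 2 : ℝ)))) s) := by
        gcongr ENNReal.ofReal (1 / 2) * ?_
        exact setLIntegral_mono' measurableSet_Ioi h2
    _ = ENNReal.ofReal (1 / 2) * (ENNReal.ofReal (v ^ (1 / 2 : ℝ) / (1 / 2)) +
          ENNReal.ofReal v * ENNReal.ofReal (v ^ (-(1 / 2) : ℝ) / (1 / 2))) := by
        rw [lintegral_add_left hmI, lintegral_const_mul' _ _ ENNReal.ofReal_ne_top,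
          setLIntegral_indicator measurableSet_Ioo, setLIntegral_indicator measurableSet_Ici,
          inter_eq_left.2 Ioo_subset_Ioi_self, inter_eq_left.2 (Ici_subset_Ioi.2 hv),
          setLIntegral_congr Ioi_ae_eq_Ici.symm, lintegral_Ioi_rpow_neg (by norm_num) hv,
          lintegral_Ioo_zero_rpow (by norm_num) hv.le]
    _ = _ := by
        rw [← ENNReal.ofReal_mul hv.le, ← ENNReal.ofReal_add (by positivity) (by positivity),
          ← ENNReal.ofReal_mul (by norm_num)]
        congr 1
        have : v * v ^ (-(1 / 2) : ℝ) = v ^ (1 / 2 : ℝ) := by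
          rw [mul_comm, ← Real.rpow_add_one hv.ne']
          norm_num
        rw [mul_div_assoc', this]
        ring

/-- Hardy's inequality for the averages of `φ` over the sublevel sets of `V`; with `V` the rank of
`φ` this is the classical inequality for the decreasing rearrangement of `φ`. -/
theorem hardy_superlevelRank [SFinite μ] {V φ : X → ℝ≥0∞} (hV : Measurable V)
    (hVμ : ∀ s, μ {x | V x ≤ s} ≤ s) (hφ : Measurable φ) {ρ : ℝ} (hρ : 1 < ρ) :
    ∫⁻ v in Ioi (0 : ℝ), ENNReal.ofReal (v ^ (-ρ)) *
        (∫⁻ x in {x | V x ≤ ENNReal.ofReal v}, φ x ∂μ) ^ ρ ≤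
      ENNReal.ofReal (2 ^ ρ / (ρ - 1)) * ∫⁻ x, φ x ^ ρ ∂μ := by
  set a : ℝ := (ρ - 1) / 2 with ha
  have ha0 : 0 < a := by simp only [ha]; linarith
  have hpq := Real.HolderConjugate.conjExponent hρ
  have hq := hpq.symm.pos
  have hqe : ρ.conjExponent = ρ / (ρ - 1) := rfl
  have hρ1 : ρ - 1 ≠ 0 := by linarith
  have hV0 : ∀ᵐ x ∂μ, V x ≠ 0 := ae_iff.2 (by simpa using hVμ 0)
  -- Hölder's inequality against the weight `V ^ (a / ρ)`
  have hstep : ∀ v ∈ Ioi (0 : ℝ), ENNReal.ofReal (v ^ (-ρ)) *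
        (∫⁻ x in {x | V x ≤ ENNReal.ofReal v}, φ x ∂μ) ^ ρ ≤
        ENNReal.ofReal (2 ^ (ρ - 1)) * ∫⁻ x, (φ x ^ ρ * V x ^ a) *
          {v : ℝ | V x ≤ ENNReal.ofReal v}.indicator
            (fun v => ENNReal.ofReal (v ^ (-1 - a))) v ∂μ := by
    intro v hv
    have hv' : (0 : ℝ) < v := hv
    set A := {x | V x ≤ ENNReal.ofReal v} with hA
    have hAm : MeasurableSet A := measurableSet_le hV measurable_const
    have e1 : ∫⁻ x in A, φ x ∂μ = ∫⁻ x in A, ((fun x => φ x * V x ^ (a / ρ)) *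
        fun x => V x ^ (-(a / ρ))) x ∂μ := by
      refine lintegral_congr_ae ?_
      filter_upwards [ae_restrict_of_ae hV0, ae_restrict_mem hAm] with x hx hxA
      have : V x ≠ ⊤ := ne_top_of_le_ne_top ENNReal.ofReal_ne_top hxA
      simp only [Pi.mul_apply]
      rw [mul_assoc, ← ENNReal.rpow_add _ _ hx this]
      simp
    have e2 := ENNReal.lintegral_mul_le_Lp_mul_Lq (μ.restrict A) hpq
      (f := fun x => φ x * V x ^ (a / ρ)) (g := fun x => V x ^ (-(a / ρ)))
      (by fun_prop) (by fun_prop)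
    rw [← e1] at e2
    have e3 : ∀ x, (φ x * V x ^ (a / ρ)) ^ ρ = φ x ^ ρ * V x ^ a := by
      intro x
      rw [ENNReal.mul_rpow_of_nonneg _ _ (by linarith), ← ENNReal.rpow_mul,
        div_mul_cancel₀ _ (by linarith)]
    have e4 : ∀ x, (V x ^ (-(a / ρ))) ^ ρ.conjExponent = V x ^ (-(1 / 2 : ℝ)) := by
      intro x
      rw [← ENNReal.rpow_mul, hqe, ha]
      congr 1
      field_simp
    simp_rw [e3, e4] at e2
    have e5 := e2.trans (mul_le_mul_right (ENNReal.rpow_le_rpow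
      (lintegral_rpow_neg_half_le hV hVμ hv') (by positivity : 0 ≤ 1 / ρ.conjExponent)) _)
    have e6 := ENNReal.rpow_le_rpow e5 (by linarith : 0 ≤ ρ)
    rw [ENNReal.mul_rpow_of_nonneg _ _ (by linarith), ← ENNReal.rpow_mul, ← ENNReal.rpow_mul,
      one_div_mul_cancel (by linarith), ENNReal.rpow_one,
      show 1 / ρ.conjExponent * ρ = ρ - 1 by rw [hqe]; field_simp,
      ENNReal.ofReal_rpow_of_pos (by positivity)] at e6
    calc _ ≤ ENNReal.ofReal (v ^ (-ρ)) * ((∫⁻ x in A, φ x ^ ρ * V x ^ a ∂μ) *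
          ENNReal.ofReal ((2 * v ^ (1 / 2 : ℝ)) ^ (ρ - 1))) := by gcongr
      _ = ENNReal.ofReal (2 ^ (ρ - 1)) * ((∫⁻ x in A, φ x ^ ρ * V x ^ a ∂μ) *
          ENNReal.ofReal (v ^ (-1 - a))) := by
          rw [mul_left_comm, mul_left_comm _ (∫⁻ x in A, φ x ^ ρ * V x ^ a ∂μ),
            ← ENNReal.ofReal_mul (by positivity), ← ENNReal.ofReal_mul (by positivity)]
          congr 2
          rw [Real.mul_rpow (by norm_num) (by positivity), ← Real.rpow_mul hv'.le, mul_left_comm,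
            ← Real.rpow_add hv']
          congr 2
          rw [ha]; ring
      _ = _ := by
          congr 1
          rw [← lintegral_mul_const' _ _ ENNReal.ofReal_ne_top, ← lintegral_indicator hAm]
          refine lintegral_congr fun x => ?_
          by_cases hx : V x ≤ ENNReal.ofReal v
          · rw [indicator_of_mem (show x ∈ A from hx),
              indicator_of_mem (show v ∈ {v : ℝ | V x ≤ ENNReal.ofReal v} from hx)]
          · rw [indicator_of_notMem (show x ∉ A from hx),
              indicator_of_notMem (show v ∉ {v : ℝ | V x ≤ ENNReal.ofReal v} from hx), mul_zero]
  have hjm : Measurable (Function.uncurry fun (v : ℝ) (x : X) => (φ x ^ ρ * V x ^ a) *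
      {v : ℝ | V x ≤ ENNReal.ofReal v}.indicator
      (fun v => ENNReal.ofReal (v ^ (-1 - a))) v) := by
    have : MeasurableSet {q : ℝ × X | V q.2 ≤ ENNReal.ofReal q.1} :=
      measurableSet_le (hV.comp measurable_snd) (ENNReal.measurable_ofReal.comp measurable_fst)
    have h2 := Measurable.indicator (f := fun q : ℝ × X => ENNReal.ofReal (q.1 ^ (-1 - a)))
      (by fun_prop) this
    exact Measurable.mul (by fun_prop) h2
  refine (setLIntegral_mono' measurableSet_Ioi hstep).trans ?_
  rw [lintegral_const_mul' _ _ ENNReal.ofReal_ne_top, lintegral_lintegral_swap hjm.aemeasurable]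
  have h3 : ∀ᵐ x ∂μ, ∫⁻ v in Ioi (0 : ℝ), (φ x ^ ρ * V x ^ a) *
      {v : ℝ | V x ≤ ENNReal.ofReal v}.indicator
      (fun v => ENNReal.ofReal (v ^ (-1 - a))) v ≤ ENNReal.ofReal (1 / a) * φ x ^ ρ := by
    filter_upwards [hV0] with x hx
    have hm : Measurable fun v : ℝ => {v : ℝ | V x ≤ ENNReal.ofReal v}.indicator
        (fun v => ENNReal.ofReal (v ^ (-1 - a))) v :=
      Measurable.indicator (by fun_prop) (measurableSet_le measurable_const (by fun_prop))
    rw [lintegral_const_mul _ hm, lintegral_indicator_le_ofReal_rpow ha0 hx]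
    calc _ = ENNReal.ofReal (1 / a) * φ x ^ ρ * (V x ^ a * V x ^ (-a)) := by ring
      _ ≤ ENNReal.ofReal (1 / a) * φ x ^ ρ * 1 := by
          gcongr
          rw [ENNReal.rpow_neg]
          exact ENNReal.mul_inv_le_one _
      _ = _ := mul_one _
  refine (mul_le_mul_right (lintegral_mono_ae h3) _).trans ?_
  rw [lintegral_const_mul' _ _ ENNReal.ofReal_ne_top, ← mul_assoc,
    ← ENNReal.ofReal_mul (by positivity)]
  gcongr
  rw [ha, Real.rpow_sub_one two_ne_zero]
  apply le_of_eq
  field_simp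

end SuperlevelRank

/-! ### The part of low values -/

theorem tsum_dyadic_rpow_le {q : ℝ} (hq : 1 ≤ q) (y : ℝ≥0∞) (hy : y ≠ ⊤) :
    ∑' k : ℤ, (if (2 : ℝ≥0∞) ^ (k : ℝ) < y then (2 : ℝ≥0∞) ^ (((k : ℝ) + 1) * q) else 0) ≤
      2 ^ (q + 1) * y ^ q := by
  rcases eq_or_ne y 0 with rfl | hy0
  · simp
  obtain ⟨N, hN1, hN2⟩ := ENNReal.exists_mem_Ioc_zpow (y := 2) hy0 hy (by norm_num) (by norm_num)
  rw [← ENNReal.rpow_intCast] at hN1 hN2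
  set g : ℤ → ℝ≥0∞ := fun j => if (2 : ℝ≥0∞) ^ ((N - j : ℤ) : ℝ) < y then
    (2 : ℝ≥0∞) ^ ((((N - j : ℤ) : ℝ) + 1) * q) else 0 with hg
  have h1 : ∑' k : ℤ, (if (2 : ℝ≥0∞) ^ (k : ℝ) < y then
      (2 : ℝ≥0∞) ^ (((k : ℝ) + 1) * q) else 0) = ∑' j, g j :=
    ((Equiv.subLeft N).tsum_eq (fun k : ℤ => if (2 : ℝ≥0∞) ^ (k : ℝ) < y then
      (2 : ℝ≥0∞) ^ (((k : ℝ) + 1) * q) else 0)).symm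
  have h2 : Function.support g ⊆ range ((↑) : ℕ → ℤ) := by
    intro j hj
    have hlt : (2 : ℝ≥0∞) ^ ((N - j : ℤ) : ℝ) < y := by
      by_contra hcon
      exact hj (by simp only [hg]; rw [if_neg hcon])
    have h4 : N - j < N + 1 := by
      by_contra! hcon
      refine (hlt.trans_le hN2).not_ge (ENNReal.rpow_le_rpow_of_exponent_le (by norm_num) ?_)
      exact_mod_cast hcon
    exact ⟨j.toNat, Int.toNat_of_nonneg (by omega)⟩
  rw [h1, ← Nat.cast_injective.tsum_eq h2]
  have h5 : ∀ j : ℕ, g j ≤ 2 ^ q * y ^ q * (2⁻¹ : ℝ≥0∞) ^ j := by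
    intro j
    simp only [hg]
    split_ifs
    swap
    · exact zero_le
    have e : ((((N - (j : ℤ) : ℤ) : ℝ) + 1) * q) = q + N * q + -(j * q) := by push_cast; ring
    rw [e, ENNReal.rpow_add _ _ (by norm_num) (by norm_num),
      ENNReal.rpow_add _ _ (by norm_num) (by norm_num), ENNReal.rpow_mul]
    gcongr
    rw [← ENNReal.rpow_natCast, ENNReal.inv_rpow, ← ENNReal.rpow_neg]
    refine ENNReal.rpow_le_rpow_of_exponent_le (by norm_num) ?_
    have : (0 : ℝ) ≤ j := by positivity
    nlinarith
  refine (ENNReal.tsum_le_tsum h5).trans ?_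
  rw [ENNReal.tsum_mul_left, ENNReal.tsum_geometric, ENNReal.one_sub_inv_two, inv_inv,
    ENNReal.rpow_add _ _ (by norm_num) (by norm_num), ENNReal.rpow_one]
  apply le_of_eq
  ring

theorem rpow_le_tsum_dyadic {p : ℝ} (hp : 0 < p) (y : ℝ≥0∞) (hy : y ≠ ⊤) :
    y ^ p ≤ ∑' k : ℤ,
      (if (2 : ℝ≥0∞) ^ (k : ℝ) < y then (2 : ℝ≥0∞) ^ (((k : ℝ) + 1) * p) else 0) := by
  rcases eq_or_ne y 0 with rfl | hy0
  · simp [hp]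
  obtain ⟨N, hN1, hN2⟩ := ENNReal.exists_mem_Ioc_zpow (y := 2) hy0 hy (by norm_num) (by norm_num)
  rw [← ENNReal.rpow_intCast] at hN1 hN2
  refine le_trans ?_ (ENNReal.le_tsum N)
  rw [if_pos hN1, ENNReal.rpow_mul]
  push_cast at hN2
  exact ENNReal.rpow_le_rpow hN2 hp.le

section LowValues

variable {X : Type*} [MeasurableSpace X] {μ : Measure X}

theorem lintegral_dyadic_superlevel {G : X → ℝ≥0∞} (hG : Measurable G) (k : ℤ) (c : ℝ≥0∞)
    (A : Set X) :
    ∫⁻ x in A, (if (2 : ℝ≥0∞) ^ (k : ℝ) < G x then c else 0) ∂μ =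
      c * μ ({x | (2 : ℝ≥0∞) ^ (k : ℝ) < G x} ∩ A) := by
  have hm : MeasurableSet {x | (2 : ℝ≥0∞) ^ (k : ℝ) < G x} := measurableSet_lt measurable_const hG
  have : ∀ x, (if (2 : ℝ≥0∞) ^ (k : ℝ) < G x then c else 0) =
      {x | (2 : ℝ≥0∞) ^ (k : ℝ) < G x}.indicator (fun _ => c) x := by
    intro x
    by_cases hx : (2 : ℝ≥0∞) ^ (k : ℝ) < G x
    · rw [if_pos hx, indicator_of_mem (show x ∈ {x | (2 : ℝ≥0∞) ^ (k : ℝ) < G x} from hx)]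
    · rw [if_neg hx, indicator_of_notMem (show x ∉ {x | (2 : ℝ≥0∞) ^ (k : ℝ) < G x} from hx)]
  simp_rw [this]
  rw [lintegral_indicator_const hm, Measure.restrict_apply hm]

/-- The estimate for the part of `G` of rank above `v`. The exponent `α` is below `1`, so that
`α`-th powers are subadditive over the dyadic levels of `G`; the factor `1 / (1 - α)`, which is the
blow-up rate of the embedding, arises from `∫_0^m v ^ (-α) dv`. -/
theorem lintegral_lt_superlevelRank_rpow_le {G : X → ℝ≥0∞} (hG : Measurable G)
    (hfin : ∀ x, G x ≠ ⊤) {p α : ℝ} (hp : 0 < p) (hα0 : 0 < α) (hα1 : α < 1) (hpα : 1 ≤ p * α) :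
    ∫⁻ v in Ioi (0 : ℝ), ENNReal.ofReal (v ^ (-α)) *
        (∫⁻ x in {x | ENNReal.ofReal v < superlevelRank μ G x}, G x ^ p ∂μ) ^ α ≤
      ENNReal.ofReal (1 / (1 - α)) * (2 ^ (p * α + 1) * ∫⁻ x, G x ^ (p * α) ∂μ) := by
  set m : ℤ → ℝ≥0∞ := fun k => μ {x | (2 : ℝ≥0∞) ^ (k : ℝ) < G x} with hm
  have hterm : ∀ k : ℤ, ∀ c : ℝ≥0∞,
      Measurable fun x => (if (2 : ℝ≥0∞) ^ (k : ℝ) < G x then c else 0) := fun k c =>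
    Measurable.ite (measurableSet_lt measurable_const hG) measurable_const measurable_const
  have hstep : ∀ v ∈ Ioi (0 : ℝ), ENNReal.ofReal (v ^ (-α)) *
        (∫⁻ x in {x | ENNReal.ofReal v < superlevelRank μ G x}, G x ^ p ∂μ) ^ α ≤
      ∑' k : ℤ, (2 ^ (((k : ℝ) + 1) * (p * α)) * m k ^ α) *
        {v : ℝ | ENNReal.ofReal v < m k}.indicator
          (fun v => ENNReal.ofReal (v ^ ((1 - α) - 1))) v := by
    intro v hv
    have h1 : ∫⁻ x in {x | ENNReal.ofReal v < superlevelRank μ G x}, G x ^ p ∂μ ≤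
        ∑' k : ℤ, 2 ^ (((k : ℝ) + 1) * p) * {v : ℝ | ENNReal.ofReal v < m k}.indicator
          (fun _ => m k) v := by
      refine (lintegral_mono fun x => rpow_le_tsum_dyadic hp (G x) (hfin x)).trans ?_
      rw [lintegral_tsum fun k => (hterm k _).aemeasurable]
      refine ENNReal.tsum_le_tsum fun k => ?_
      rw [lintegral_dyadic_superlevel hG]
      gcongr
      by_cases hvk : ENNReal.ofReal v < m k
      · rw [indicator_of_mem (show v ∈ {v : ℝ | ENNReal.ofReal v < m k} from hvk)]
        exact measure_mono inter_subset_left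
      · -- a point of rank above `v` whose value exceeds `2 ^ k` forces `v < m k`
        have : {x | (2 : ℝ≥0∞) ^ (k : ℝ) < G x} ∩
            {x | ENNReal.ofReal v < superlevelRank μ G x} = ∅ := by
          refine eq_empty_iff_forall_notMem.2 fun x hx => hvk ?_
          exact lt_of_lt_of_le hx.2 (measure_mono fun y (hy : G x ≤ G y) =>
            show (2 : ℝ≥0∞) ^ (k : ℝ) < G y from lt_of_lt_of_le hx.1 hy)
        rw [this, measure_empty]
        exact zero_le
    calc _ ≤ ENNReal.ofReal (v ^ (-α)) *
        ∑' k : ℤ, (2 ^ (((k : ℝ) + 1) * p) * {v : ℝ | ENNReal.ofReal v < m k}.indicator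
          (fun _ => m k) v) ^ α := by
          gcongr
          exact (ENNReal.rpow_le_rpow h1 hα0.le).trans
            (ENNReal.tsum_rpow_le_tsum_rpow _ hα0 hα1.le)
      _ = _ := by
          rw [← ENNReal.tsum_mul_left]
          refine tsum_congr fun k => ?_
          rw [ENNReal.mul_rpow_of_nonneg _ _ hα0.le, ← ENNReal.rpow_mul, mul_assoc _ p α]
          by_cases hvk : ENNReal.ofReal v < m k
          · rw [indicator_of_mem (show v ∈ {v : ℝ | ENNReal.ofReal v < m k} from hvk),
              indicator_of_mem (show v ∈ {v : ℝ | ENNReal.ofReal v < m k} from hvk),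
              show 1 - α - 1 = -α by ring]
            ring
          · rw [indicator_of_notMem (show v ∉ {v : ℝ | ENNReal.ofReal v < m k} from hvk),
              indicator_of_notMem (show v ∉ {v : ℝ | ENNReal.ofReal v < m k} from hvk),
              ENNReal.zero_rpow_of_pos hα0]
            simp
  refine (setLIntegral_mono' measurableSet_Ioi hstep).trans ?_
  have hmi : ∀ k, Measurable fun v : ℝ => {v : ℝ | ENNReal.ofReal v < m k}.indicator
      (fun v => ENNReal.ofReal (v ^ ((1 - α) - 1))) v := fun k =>
    Measurable.indicator (by fun_prop) (measurableSet_lt (by fun_prop) measurable_const)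
  rw [lintegral_tsum fun k => ((hmi k).const_mul _).aemeasurable]
  calc _ ≤ ∑' k : ℤ, ENNReal.ofReal (1 / (1 - α)) * (2 ^ (((k : ℝ) + 1) * (p * α)) * m k) := by
        refine ENNReal.tsum_le_tsum fun k => ?_
        rw [lintegral_const_mul _ (hmi k)]
        refine (mul_le_mul_right
          (lintegral_indicator_ofReal_lt_rpow (by linarith : 0 < 1 - α) (m k)) _).trans ?_
        apply le_of_eq
        have : m k ^ α * m k ^ (1 - α) = m k := by
          rw [← ENNReal.rpow_add_of_nonneg _ _ hα0.le (by linarith)]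
          simp
        calc _ = ENNReal.ofReal (1 / (1 - α)) * (2 ^ (((k : ℝ) + 1) * (p * α)) *
              (m k ^ α * m k ^ (1 - α))) := by ring
          _ = _ := by rw [this]
    _ = ENNReal.ofReal (1 / (1 - α)) * ∫⁻ x, ∑' k : ℤ, (if (2 : ℝ≥0∞) ^ (k : ℝ) < G x then
          (2 : ℝ≥0∞) ^ (((k : ℝ) + 1) * (p * α)) else 0) ∂μ := by
        rw [ENNReal.tsum_mul_left, lintegral_tsum fun k => (hterm k _).aemeasurable]
        congr 2
        ext k
        have := lintegral_dyadic_superlevel (μ := μ) hG k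
          ((2 : ℝ≥0∞) ^ (((k : ℝ) + 1) * (p * α))) univ
        rw [Measure.restrict_univ, inter_univ] at this
        rw [this]
    _ ≤ _ := by
        gcongr
        rw [← lintegral_const_mul _ (by fun_prop)]
        exact lintegral_mono fun x => tsum_dyadic_rpow_le hpα _ (hfin x)

end LowValues

/-- The substitution `v = κ t ^ n` in an integral with respect to `dt / t`. -/
theorem lintegral_Ioi_comp_mul_pow {n : ℕ} (hn : n ≠ 0) {κ : ℝ} (hκ : 0 < κ) (F : ℝ → ℝ≥0∞) :
    ∫⁻ t in Ioi (0 : ℝ), F (κ * t ^ n) * ENNReal.ofReal (1 / t) =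
      ENNReal.ofReal (1 / n) * ∫⁻ v in Ioi (0 : ℝ), F v * ENNReal.ofReal (1 / v) := by
  have hn' : (0 : ℝ) < n := by positivity
  have himage : (fun t : ℝ => κ * t ^ n) '' Ioi 0 = Ioi 0 := by
    ext v
    constructor
    · rintro ⟨t, ht, rfl⟩
      have ht' : (0 : ℝ) < t := ht
      exact mem_Ioi.2 (by positivity)
    · intro hv
      have hv' : (0 : ℝ) < v := hv
      refine ⟨(v / κ) ^ (1 / n : ℝ), mem_Ioi.2 (by positivity), ?_⟩
      simp only
      rw [← Real.rpow_natCast, ← Real.rpow_mul (by positivity), one_div_mul_cancel hn'.ne',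
        Real.rpow_one]
      field_simp
  have hinj : InjOn (fun t : ℝ => κ * t ^ n) (Ioi 0) := by
    intro s hs t ht hst
    have : s ^ n = t ^ n := mul_left_cancel₀ hκ.ne' hst
    exact (pow_left_inj₀ (le_of_lt hs) (le_of_lt ht) hn).1 this
  have hder : ∀ t ∈ Ioi (0 : ℝ), HasDerivWithinAt (fun t : ℝ => κ * t ^ n)
      (κ * (n * t ^ (n - 1))) (Ioi 0) t := fun t _ =>
    ((hasDerivAt_pow n t).const_mul κ).hasDerivWithinAt
  have h := lintegral_image_eq_lintegral_abs_deriv_mul measurableSet_Ioi hder hinj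
    (fun v => F v * ENNReal.ofReal (1 / v))
  rw [himage] at h
  rw [h, ← lintegral_const_mul' _ _ ENNReal.ofReal_ne_top]
  refine setLIntegral_congr_fun measurableSet_Ioi fun t ht => ?_
  have ht' : (0 : ℝ) < t := ht
  rw [mul_left_comm (ENNReal.ofReal |_|), mul_left_comm (ENNReal.ofReal (1 / (n : ℝ))), ← ENNReal.ofReal_mul (by positivity),
    ← ENNReal.ofReal_mul (by positivity), abs_of_pos (by positivity)]
  congr 2
  obtain ⟨k, rfl⟩ := Nat.exists_eq_succ_of_ne_zero hn
  simp only [Nat.succ_eq_add_one, Nat.add_sub_cancel]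
  field_simp
  ring

/-! ### Averages along segments -/

section Averages

variable {n : ℕ}

/-- The uniform probability measure on the ball of radius `T` about the origin. -/
noncomputable def ballUniform (n : ℕ) (T : ℝ) : Measure (EuclideanSpace ℝ (Fin n)) :=
  ProbabilityTheory.cond volume (Metric.ball 0 T)

theorem isProbabilityMeasure_ballUniform {T : ℝ} (hT : 0 < T) :
    IsProbabilityMeasure (ballUniform n T) :=
  ProbabilityTheory.cond_isProbabilityMeasure_of_finite
    (Metric.measure_ball_pos _ _ hT).ne' measure_ball_lt_top.ne

instance (T : ℝ) : SFinite (ballUniform n T) := by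
  unfold ballUniform ProbabilityTheory.cond
  infer_instance

theorem lintegral_ballUniform (T : ℝ) (F : EuclideanSpace ℝ (Fin n) → ℝ≥0∞) :
    ∫⁻ w, F w ∂(ballUniform n T) =
      (volume (Metric.ball (0 : EuclideanSpace ℝ (Fin n)) T))⁻¹ *
        ∫⁻ w in Metric.ball 0 T, F w := by
  rw [ballUniform, ProbabilityTheory.cond, lintegral_smul_measure, smul_eq_mul]

/-- The average of `G` over the points `x + s w`, with `s` uniform in `(0, 1)` and `w` uniform in
the ball of radius `T`. -/
noncomputable def segmentAverage (T : ℝ) (G : EuclideanSpace ℝ (Fin n) → ℝ≥0∞)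
    (x : EuclideanSpace ℝ (Fin n)) : ℝ≥0∞ :=
  ∫⁻ s in Ioo (0 : ℝ) 1, ∫⁻ w, G (x + s • w) ∂(ballUniform n T)

theorem measurable_lintegral_ballUniform (T : ℝ) {G : EuclideanSpace ℝ (Fin n) → ℝ≥0∞}
    (hG : Measurable G) :
    Measurable fun q : EuclideanSpace ℝ (Fin n) × ℝ =>
      ∫⁻ w, G (q.1 + q.2 • w) ∂(ballUniform n T) := by
  refine Measurable.lintegral_prod_right' (f := fun q : (EuclideanSpace ℝ (Fin n) × ℝ) ×
    EuclideanSpace ℝ (Fin n) => G (q.1.1 + q.1.2 • q.2)) (by fun_prop)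

theorem measurable_segmentAverage (T : ℝ) {G : EuclideanSpace ℝ (Fin n) → ℝ≥0∞}
    (hG : Measurable G) : Measurable (segmentAverage T G) :=
  Measurable.lintegral_prod_right' (measurable_lintegral_ballUniform T hG)

theorem segmentAverage_add (T : ℝ) {G₁ G₂ : EuclideanSpace ℝ (Fin n) → ℝ≥0∞}
    (h₁ : Measurable G₁) (x : EuclideanSpace ℝ (Fin n)) :
    segmentAverage T (fun y => G₁ y + G₂ y) x = segmentAverage T G₁ x + segmentAverage T G₂ x := by
  unfold segmentAverage
  rw [← lintegral_add_left]
  · refine lintegral_congr fun s => ?_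
    rw [lintegral_add_left (by fun_prop)]
  · exact (measurable_lintegral_ballUniform T h₁).comp (by fun_prop : Measurable fun s => (x, s))

theorem lintegral_lintegral_ballUniform {T : ℝ} (hT : 0 < T)
    {G : EuclideanSpace ℝ (Fin n) → ℝ≥0∞} (hG : Measurable G) (s : ℝ) :
    ∫⁻ x, ∫⁻ w, G (x + s • w) ∂(ballUniform n T) = ∫⁻ x, G x := by
  have := isProbabilityMeasure_ballUniform (n := n) hT
  rw [lintegral_lintegral_swap (by fun_prop)]
  simp_rw [lintegral_add_right_eq_self]
  simp

/-- Being an average of translations, `segmentAverage T` is a contraction of `L^p`. -/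
theorem lintegral_segmentAverage_rpow_le {T : ℝ} (hT : 0 < T)
    {G : EuclideanSpace ℝ (Fin n) → ℝ≥0∞} (hG : Measurable G) {p : ℝ} (hp : 1 ≤ p) :
    ∫⁻ x, segmentAverage T G x ^ p ≤ ∫⁻ x, G x ^ p := by
  have := isProbabilityMeasure_ballUniform (n := n) hT
  have hm := measurable_lintegral_ballUniform T hG
  have hmp := measurable_lintegral_ballUniform T (hG.pow_const p)
  calc ∫⁻ x, segmentAverage T G x ^ p
      ≤ ∫⁻ x, ∫⁻ s in Ioo (0 : ℝ) 1, ∫⁻ w, G (x + s • w) ^ p ∂(ballUniform n T) := by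
        refine lintegral_mono fun x => ?_
        refine (lintegral_rpow_le_lintegral_rpow (by simp) hp ?_).trans ?_
        · exact (hm.comp (by fun_prop : Measurable fun s => (x, s))).aemeasurable
        · refine lintegral_mono fun s => ?_
          exact lintegral_rpow_le_lintegral_rpow (by simp) hp (by fun_prop)
    _ = ∫⁻ s in Ioo (0 : ℝ) 1, ∫⁻ x, G x ^ p := by
        rw [lintegral_lintegral_swap hmp.aemeasurable]
        refine lintegral_congr fun s => ?_
        exact lintegral_lintegral_ballUniform hT (hG.pow_const p) s
    _ = _ := by simp

theorem lintegral_comp_add_smul {F : EuclideanSpace ℝ (Fin n) → ℝ≥0∞} (hF : Measurable F)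
    (x : EuclideanSpace ℝ (Fin n)) {s : ℝ} (hs : 0 < s) :
    ∫⁻ w, F (x + s • w) = ENNReal.ofReal (s ^ (-(n : ℝ))) * ∫⁻ w, F w := by
  have h := Measure.map_addHaar_smul (volume : Measure (EuclideanSpace ℝ (Fin n))) hs.ne'
  have h2 : ∫⁻ w, F (x + w) ∂(Measure.map (fun w => s • w) volume) = ∫⁻ w, F (x + s • w) :=
    lintegral_map (f := fun w => F (x + w)) (by fun_prop) (by fun_prop)
  rw [← h2]
  have h3 : (fun w : EuclideanSpace ℝ (Fin n) => s • w) = (s • ·) := rfl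
  rw [h3, h, lintegral_smul_measure, smul_eq_mul, lintegral_add_left_eq_self]
  congr 2
  rw [abs_of_pos (by positivity), Real.rpow_neg hs.le, Real.rpow_natCast, finrank_euclideanSpace,
    Fintype.card_fin]

theorem rpow_lintegral_ballUniform_le {T : ℝ} (hT : 0 < T)
    {G : EuclideanSpace ℝ (Fin n) → ℝ≥0∞} (hG : Measurable G) {r : ℝ} (hr : 1 ≤ r)
    (x : EuclideanSpace ℝ (Fin n)) {s : ℝ} (hs : 0 < s) :
    (∫⁻ w, G (x + s • w) ∂(ballUniform n T)) ^ r ≤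
      (volume (Metric.ball (0 : EuclideanSpace ℝ (Fin n)) T))⁻¹ *
        (ENNReal.ofReal (s ^ (-(n : ℝ))) * ∫⁻ y, G y ^ r) := by
  have := isProbabilityMeasure_ballUniform (n := n) hT
  refine (lintegral_rpow_le_lintegral_rpow (by simp) hr (by fun_prop)).trans ?_
  rw [lintegral_ballUniform]
  gcongr
  rw [← lintegral_comp_add_smul (hG.pow_const r) x hs]
  exact setLIntegral_le_lintegral _ _

/-- The average over a ball of radius `s T` maps `L^r` to `L^p`: combine its sup bound by the
`L^r` norm with its contractivity on `L^r`. -/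
theorem lintegral_rpow_lintegral_ballUniform_le {T : ℝ} (hT : 0 < T)
    {G : EuclideanSpace ℝ (Fin n) → ℝ≥0∞} (hG : Measurable G) {r p : ℝ} (hr : 1 ≤ r) (hrp : r ≤ p)
    {s : ℝ} (hs : 0 < s) :
    ∫⁻ x, (∫⁻ w, G (x + s • w) ∂(ballUniform n T)) ^ p ≤
      ENNReal.ofReal (s ^ (-(n * (p - r) / r))) *
        ((volume (Metric.ball (0 : EuclideanSpace ℝ (Fin n)) T))⁻¹ ^ ((p - r) / r) *
        (∫⁻ y, G y ^ r) ^ (p / r)) := by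
  have := isProbabilityMeasure_ballUniform (n := n) hT
  have hr0 : 0 < r := by linarith
  have he : 0 ≤ (p - r) / r := div_nonneg (by linarith) hr0.le
  set I := ∫⁻ y, G y ^ r with hI
  set D := (volume (Metric.ball (0 : EuclideanSpace ℝ (Fin n)) T))⁻¹ *
        (ENNReal.ofReal (s ^ (-(n : ℝ))) * I) with hD
  have hpt : ∀ x, (∫⁻ w, G (x + s • w) ∂(ballUniform n T)) ^ p ≤
      D ^ ((p - r) / r) * ∫⁻ w, G (x + s • w) ^ r ∂(ballUniform n T) := by
    intro x
    have h1 := rpow_lintegral_ballUniform_le hT hG hr x hs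
    have h2 : (∫⁻ w, G (x + s • w) ∂(ballUniform n T)) ^ r ≤
        ∫⁻ w, G (x + s • w) ^ r ∂(ballUniform n T) :=
      lintegral_rpow_le_lintegral_rpow (by simp) hr (by fun_prop)
    have h3 : p = r * ((p - r) / r) + r := by field_simp; ring
    rw [h3, ENNReal.rpow_add_of_nonneg _ _ (by positivity) hr0.le, ENNReal.rpow_mul, ← h3]
    exact mul_le_mul' (ENNReal.rpow_le_rpow h1 he) h2
  refine (lintegral_mono hpt).trans ?_
  have hmx : Measurable fun x => ∫⁻ w, G (x + s • w) ^ r ∂(ballUniform n T) :=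
    (measurable_lintegral_ballUniform T (hG.pow_const r)).comp
      (by fun_prop : Measurable fun x => (x, s))
  rw [lintegral_const_mul _ hmx,
    lintegral_lintegral_ballUniform hT (hG.pow_const r) s, ← hI, hD,
    ENNReal.mul_rpow_of_nonneg _ _ he, ENNReal.mul_rpow_of_nonneg _ _ he,
    ENNReal.ofReal_rpow_of_pos (by positivity), ← Real.rpow_mul hs.le]
  apply le_of_eq
  have h4 : I ^ (p / r) = I ^ ((p - r) / r) * I := by
    conv_rhs => rw [← ENNReal.rpow_one I, ← ENNReal.rpow_mul, one_mul]
    rw [← ENNReal.rpow_add_of_nonneg _ _ he zero_le_one]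
    congr 1
    field_simp
    ring
  rw [h4, show -(n : ℝ) * ((p - r) / r) = -(n * (p - r) / r) by ring]
  ring

/-- Jensen's inequality for the probability density `δ s ^ (δ - 1)` on `(0, 1)`: for small `δ` it
gains a power of `s` of exponent nearly `p - 1`. -/
theorem rpow_lintegral_Ioo_le {δ p : ℝ} (hδ : 0 < δ) (hp : 1 ≤ p) {M : ℝ → ℝ≥0∞}
    (hM : Measurable M) :
    (∫⁻ s in Ioo (0 : ℝ) 1, M s) ^ p ≤ ENNReal.ofReal (δ ^ (1 - p)) *
      ∫⁻ s in Ioo (0 : ℝ) 1, ENNReal.ofReal (s ^ ((1 - δ) * (p - 1))) * M s ^ p := by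
  set d : ℝ → ℝ≥0∞ := fun s => ENNReal.ofReal (δ * s ^ (δ - 1)) with hd
  have hdm : Measurable d := by fun_prop
  set η : Measure ℝ := (volume.restrict (Ioo (0 : ℝ) 1)).withDensity d with hη
  have hη1 : η univ ≤ 1 := by
    rw [hη, withDensity_apply _ MeasurableSet.univ, Measure.restrict_univ]
    simp only [hd]
    simp_rw [ENNReal.ofReal_mul hδ.le]
    rw [lintegral_const_mul' _ _ ENNReal.ofReal_ne_top, lintegral_Ioo_zero_rpow hδ zero_le_one,
      ← ENNReal.ofReal_mul hδ.le, Real.one_rpow, mul_one_div_cancel hδ.ne', ENNReal.ofReal_one]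
  have hF : Measurable fun s : ℝ => ENNReal.ofReal (δ⁻¹ * s ^ (1 - δ)) * M s := by fun_prop
  have h := lintegral_rpow_le_lintegral_rpow hη1 hp hF.aemeasurable
  rw [hη, lintegral_withDensity_eq_lintegral_mul _ hdm hF,
    lintegral_withDensity_eq_lintegral_mul _ hdm (hF.pow_const p)] at h
  convert h using 1
  · congr 1
    refine setLIntegral_congr_fun measurableSet_Ioo fun s hs => ?_
    have hs0 : 0 < s := hs.1
    simp only [Pi.mul_apply, hd]
    rw [← mul_assoc, ← ENNReal.ofReal_mul (by positivity)]
    have : δ * s ^ (δ - 1) * (δ⁻¹ * s ^ (1 - δ)) = 1 := by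
      calc _ = (δ * δ⁻¹) * (s ^ (δ - 1) * s ^ (1 - δ)) := by ring
        _ = 1 := by
          rw [mul_inv_cancel₀ hδ.ne', ← Real.rpow_add hs0]
          simp
    rw [this, ENNReal.ofReal_one, one_mul]
  · rw [← lintegral_const_mul' _ _ ENNReal.ofReal_ne_top]
    refine setLIntegral_congr_fun measurableSet_Ioo fun s hs => ?_
    have hs0 : 0 < s := hs.1
    simp only [Pi.mul_apply, hd]
    rw [ENNReal.mul_rpow_of_nonneg _ _ (by linarith), ENNReal.ofReal_rpow_of_pos (by positivity),
      ← mul_assoc, ← mul_assoc, ← ENNReal.ofReal_mul (by positivity),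
      ← ENNReal.ofReal_mul (by positivity)]
    congr 2
    rw [Real.mul_rpow (by positivity) (by positivity), ← Real.rpow_mul hs0.le,
      Real.inv_rpow hδ.le, ← Real.rpow_neg hδ.le]
    calc _ = (δ ^ (1 : ℝ) * δ ^ (-p)) * s ^ ((1 - δ) * (p - 1)) := by
          rw [← Real.rpow_add hδ]; ring_nf
      _ = (δ ^ (1 : ℝ) * δ ^ (-p)) * (s ^ (δ - 1) * s ^ ((1 - δ) * p)) := by
          rw [← Real.rpow_add hs0]; ring_nf
      _ = _ := by rw [Real.rpow_one]; ring

/-- The smoothing property of `segmentAverage`: it maps `L^r` to `L^p` for exponents `r ≤ p` with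
`n (p - r) / r ≤ p - 1`, with a constant that depends only on an upper bound `P` of `p`. -/
theorem lintegral_segmentAverage_rpow_le_of_lt {T : ℝ} (hT : 0 < T)
    {G : EuclideanSpace ℝ (Fin n) → ℝ≥0∞} (hG : Measurable G) {r p P : ℝ} (hr : 1 ≤ r)
    (hrp : r ≤ p) (hpP : p ≤ P) (hexp : n * (p - r) / r ≤ p - 1) :
    ∫⁻ x, segmentAverage T G x ^ p ≤ ENNReal.ofReal (4 * P) ^ p *
        ((volume (Metric.ball (0 : EuclideanSpace ℝ (Fin n)) T))⁻¹ ^ ((p - r) / r) *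
        (∫⁻ y, G y ^ r) ^ (p / r)) := by
  have hp : 1 ≤ p := hr.trans hrp
  have hP : 1 ≤ P := hp.trans hpP
  -- with this choice `δ (p - 1) ≤ 1 / 2`, so that the integrable power `s ^ (-1 / 2)` remains
  set δ : ℝ := 1 / (2 * P) with hδ
  have hδ0 : 0 < δ := by positivity
  have hm := measurable_lintegral_ballUniform T hG
  set R := (volume (Metric.ball (0 : EuclideanSpace ℝ (Fin n)) T))⁻¹ ^ ((p - r) / r) *
        (∫⁻ y, G y ^ r) ^ (p / r) with hR
  have hjm : Measurable fun q : EuclideanSpace ℝ (Fin n) × ℝ =>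
      ENNReal.ofReal (q.2 ^ ((1 - δ) * (p - 1))) *
        (∫⁻ w, G (q.1 + q.2 • w) ∂(ballUniform n T)) ^ p := by
    exact Measurable.mul (by fun_prop) (hm.pow_const p)
  calc ∫⁻ x, segmentAverage T G x ^ p
      ≤ ∫⁻ x, ENNReal.ofReal (δ ^ (1 - p)) * ∫⁻ s in Ioo (0 : ℝ) 1,
          ENNReal.ofReal (s ^ ((1 - δ) * (p - 1))) *
          (∫⁻ w, G (x + s • w) ∂(ballUniform n T)) ^ p := by
        refine lintegral_mono fun x => ?_
        exact rpow_lintegral_Ioo_le hδ0 hp (hm.comp (by fun_prop : Measurable fun s => (x, s)))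
    _ = ENNReal.ofReal (δ ^ (1 - p)) * ∫⁻ s in Ioo (0 : ℝ) 1,
          ENNReal.ofReal (s ^ ((1 - δ) * (p - 1))) *
          ∫⁻ x, (∫⁻ w, G (x + s • w) ∂(ballUniform n T)) ^ p := by
        rw [lintegral_const_mul' _ _ ENNReal.ofReal_ne_top,
          lintegral_lintegral_swap hjm.aemeasurable]
        congr 1
        refine lintegral_congr fun s => ?_
        rw [lintegral_const_mul' _ _ ENNReal.ofReal_ne_top]
    _ ≤ ENNReal.ofReal (δ ^ (1 - p)) * ∫⁻ s in Ioo (0 : ℝ) 1,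
          ENNReal.ofReal (s ^ ((1 / 2 : ℝ) - 1)) * R := by
        gcongr ENNReal.ofReal (δ ^ (1 - p)) * ?_
        refine setLIntegral_mono' measurableSet_Ioo fun s hs => ?_
        have hs0 : 0 < s := hs.1
        refine (mul_le_mul_right (lintegral_rpow_lintegral_ballUniform_le hT hG hr hrp hs0)
          _).trans ?_
        rw [← mul_assoc, ← ENNReal.ofReal_mul (by positivity), ← Real.rpow_add hs0]
        gcongr ENNReal.ofReal ?_ * _
        refine Real.rpow_le_rpow_of_exponent_ge hs0 hs.2.le ?_
        have : δ * (p - 1) ≤ 1 / 2 := by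
          rw [hδ, one_div_mul_eq_div, div_le_iff₀ (by positivity)]
          linarith
        linarith
    _ = ENNReal.ofReal (δ ^ (1 - p) * 2) * R := by
        rw [lintegral_mul_const _ (by fun_prop), lintegral_Ioo_zero_rpow (by norm_num) zero_le_one,
          ← mul_assoc, ← ENNReal.ofReal_mul (by positivity), Real.one_rpow]
        norm_num
    _ ≤ _ := by
        gcongr
        rw [ENNReal.ofReal_rpow_of_pos (by positivity)]
        gcongr
        have e1 : δ ^ (1 - p) = (2 * P) ^ (p - 1) := by
          rw [hδ, one_div, Real.inv_rpow (by positivity), ← Real.rpow_neg (by positivity), neg_sub]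
        rw [e1]
        have e2 : (4 * P) ^ p = 2 ^ p * (2 * P) ^ p := by
          rw [← Real.mul_rpow (by norm_num) (by positivity)]
          ring_nf
        rw [e2, mul_comm]
        gcongr
        · exact Real.self_le_rpow_of_one_le (by norm_num) hp
        · linarith
        · linarith

end Averages

/-! ### First-order differences of `C¹` functions -/

section Smooth

variable {n : ℕ}

theorem volume_ball_euclideanSpace {t : ℝ} (ht : 0 < t) :
    volume (Metric.ball (0 : EuclideanSpace ℝ (Fin n)) t) =
      ENNReal.ofReal (t ^ n) * volume (Metric.ball (0 : EuclideanSpace ℝ (Fin n)) 1) := by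
  have := Measure.addHaar_ball_of_pos (volume : Measure (EuclideanSpace ℝ (Fin n))) 0 ht
  rwa [finrank_euclideanSpace, Fintype.card_fin] at this

theorem enorm_sub_le_lintegral_fderiv {f : EuclideanSpace ℝ (Fin n) → ℝ} (hf : ContDiff ℝ 1 f)
    (x w : EuclideanSpace ℝ (Fin n)) :
    ‖f (x + w) - f x‖ₑ ≤ ‖w‖ₑ * ∫⁻ s in Ioo (0 : ℝ) 1, ‖fderiv ℝ f (x + s • w)‖ₑ := by
  have hder : ∀ s ∈ uIcc (0 : ℝ) 1, HasDerivAt (fun s : ℝ => f (x + s • w))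
      (fderiv ℝ f (x + s • w) w) s := by
    intro s _
    have h1 : HasDerivAt (fun s : ℝ => x + s • w) w s := by
      simpa using ((hasDerivAt_id s).smul_const w).const_add x
    exact ((hf.differentiable one_ne_zero _).hasFDerivAt).comp_hasDerivAt s h1
  have hcont : Continuous fun s : ℝ => fderiv ℝ f (x + s • w) w :=
    ((hf.continuous_fderiv one_ne_zero).comp (by fun_prop)).clm_apply continuous_const
  have h := intervalIntegral.integral_eq_sub_of_hasDerivAt hder
    (hcont.intervalIntegrable 0 1)
  simp only [one_smul, zero_smul, add_zero] at h
  rw [← h, intervalIntegral.integral_of_le zero_le_one, integral_Ioc_eq_integral_Ioo]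
  refine (enorm_integral_le_lintegral_enorm _).trans ?_
  rw [← lintegral_const_mul' _ _ enorm_ne_top]
  refine lintegral_mono fun s => ?_
  rw [mul_comm]
  exact (fderiv ℝ f (x + s • w)).le_opENorm w

theorem measurable_enorm_fderiv {f : EuclideanSpace ℝ (Fin n) → ℝ} (hf : ContDiff ℝ 1 f) :
    Measurable fun x => ‖fderiv ℝ f x‖ₑ :=
  (hf.continuous_fderiv one_ne_zero).enorm.measurable

theorem lintegral_enorm_sub_ballUniform_le {f : EuclideanSpace ℝ (Fin n) → ℝ}
    (hf : ContDiff ℝ 1 f) (T : ℝ) (x : EuclideanSpace ℝ (Fin n)) :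
    ∫⁻ w, ‖f (x + w) - f x‖ₑ ∂(ballUniform n T) ≤
      ENNReal.ofReal T * segmentAverage T (fun y => ‖fderiv ℝ f y‖ₑ) x := by
  have hG := measurable_enorm_fderiv hf
  have hball : ∀ᵐ w ∂(ballUniform n T), ‖w‖ₑ ≤ ENNReal.ofReal T := by
    have : ∀ᵐ w ∂(volume.restrict (Metric.ball (0 : EuclideanSpace ℝ (Fin n)) T)),
        ‖w‖ₑ ≤ ENNReal.ofReal T := by
      filter_upwards [ae_restrict_mem Metric.isOpen_ball.measurableSet] with w hw
      rw [← ofReal_norm]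
      exact ENNReal.ofReal_le_ofReal (mem_ball_zero_iff.1 hw).le
    exact Measure.ae_smul_measure this _
  calc _ ≤ ∫⁻ w, ENNReal.ofReal T * (∫⁻ s in Ioo (0 : ℝ) 1, ‖fderiv ℝ f (x + s • w)‖ₑ)
        ∂(ballUniform n T) := by
        refine lintegral_mono_ae ?_
        filter_upwards [hball] with w hw
        exact (enorm_sub_le_lintegral_fderiv hf x w).trans (by gcongr)
    _ = _ := by
        rw [lintegral_const_mul' _ _ ENNReal.ofReal_ne_top, segmentAverage]
        congr 1
        refine lintegral_lintegral_swap (Measurable.aemeasurable ?_)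
        exact hG.comp (by fun_prop :
          Measurable fun q : EuclideanSpace ℝ (Fin n) × ℝ => x + q.2 • q.1)

theorem lintegral_ballUniform_comp_sub_le {t : ℝ} (ht : 0 < t)
    {h : EuclideanSpace ℝ (Fin n)} (hh : h ∈ Metric.ball 0 t)
    (F : EuclideanSpace ℝ (Fin n) → ℝ≥0∞) :
    ∫⁻ w, F (w - h) ∂(ballUniform n t) ≤ 2 ^ n * ∫⁻ w, F w ∂(ballUniform n (2 * t)) := by
  have hvol : volume (Metric.ball (0 : EuclideanSpace ℝ (Fin n)) (2 * t)) =
      2 ^ n * volume (Metric.ball (0 : EuclideanSpace ℝ (Fin n)) t) := by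
    rw [volume_ball_euclideanSpace (by positivity), volume_ball_euclideanSpace ht, mul_pow,
      ENNReal.ofReal_mul (by positivity), ENNReal.ofReal_pow (by norm_num), ENNReal.ofReal_ofNat,
      mul_assoc]
  rw [lintegral_ballUniform, lintegral_ballUniform, hvol,
    ENNReal.mul_inv (Or.inl (by positivity)) (Or.inl (by simp)), ← mul_assoc, ← mul_assoc,
    ENNReal.mul_inv_cancel (by positivity) (by simp), one_mul]
  refine mul_le_mul_right ?_ _
  rw [← lintegral_indicator Metric.isOpen_ball.measurableSet,
    ← lintegral_indicator Metric.isOpen_ball.measurableSet,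
    ← lintegral_add_right_eq_self _ h]
  refine lintegral_mono fun w => ?_
  by_cases hw : w + h ∈ Metric.ball (0 : EuclideanSpace ℝ (Fin n)) t
  · have hw2 : w ∈ Metric.ball (0 : EuclideanSpace ℝ (Fin n)) (2 * t) := by
      rw [mem_ball_zero_iff] at *
      calc ‖w‖ = ‖(w + h) - h‖ := by simp
        _ ≤ ‖w + h‖ + ‖h‖ := norm_sub_le _ _
        _ < 2 * t := by linarith
    rw [indicator_of_mem hw, indicator_of_mem hw2, add_sub_cancel_right]
  · rw [indicator_of_notMem hw]
    exact zero_le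

/-- Compare both `f (x + h)` and `f x` with the values of `f` on the ball of radius `t` about `x`. -/
theorem enorm_sub_le_segmentAverage {f : EuclideanSpace ℝ (Fin n) → ℝ} (hf : ContDiff ℝ 1 f)
    {t : ℝ} (ht : 0 < t) {h : EuclideanSpace ℝ (Fin n)} (hh : h ∈ Metric.ball 0 t)
    (x : EuclideanSpace ℝ (Fin n)) :
    ‖f (x + h) - f x‖ₑ ≤ ENNReal.ofReal (2 ^ (n + 1) * t) *
      (segmentAverage (2 * t) (fun y => ‖fderiv ℝ f y‖ₑ) (x + h) +
        segmentAverage (2 * t) (fun y => ‖fderiv ℝ f y‖ₑ) x) := by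
  have := isProbabilityMeasure_ballUniform (n := n) ht
  have hfm : Measurable f := hf.continuous.measurable
  have e1 : ∫⁻ w, ‖f (x + h) - f (x + w)‖ₑ ∂(ballUniform n t) ≤
      2 ^ n * ∫⁻ w, ‖f (x + h + w) - f (x + h)‖ₑ ∂(ballUniform n (2 * t)) := by
    convert lintegral_ballUniform_comp_sub_le ht hh
      (fun w => ‖f (x + h + w) - f (x + h)‖ₑ) using 1
    refine lintegral_congr fun w => ?_
    rw [← enorm_neg, neg_sub]
    congr 3
    abel
  have e2 : ∫⁻ w, ‖f (x + w) - f x‖ₑ ∂(ballUniform n t) ≤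
      2 ^ n * ∫⁻ w, ‖f (x + w) - f x‖ₑ ∂(ballUniform n (2 * t)) := by
    have := lintegral_ballUniform_comp_sub_le ht (Metric.mem_ball_self ht)
      (fun w => ‖f (x + w) - f x‖ₑ)
    simpa using this
  calc ‖f (x + h) - f x‖ₑ = ∫⁻ _, ‖f (x + h) - f x‖ₑ ∂(ballUniform n t) := by simp
    _ ≤ ∫⁻ w, (‖f (x + h) - f (x + w)‖ₑ + ‖f (x + w) - f x‖ₑ) ∂(ballUniform n t) := by
        refine lintegral_mono fun w => ?_
        calc _ = ‖(f (x + h) - f (x + w)) + (f (x + w) - f x)‖ₑ := by rw [sub_add_sub_cancel]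
          _ ≤ _ := enorm_add_le _ _
    _ = ∫⁻ w, ‖f (x + h) - f (x + w)‖ₑ ∂(ballUniform n t) +
          ∫⁻ w, ‖f (x + w) - f x‖ₑ ∂(ballUniform n t) := lintegral_add_left (by fun_prop) _
    _ ≤ 2 ^ n * (ENNReal.ofReal (2 * t) * segmentAverage (2 * t) (fun y => ‖fderiv ℝ f y‖ₑ) (x + h))
        + 2 ^ n * (ENNReal.ofReal (2 * t) * segmentAverage (2 * t) (fun y => ‖fderiv ℝ f y‖ₑ) x) := by
        refine add_le_add (e1.trans ?_) (e2.trans ?_)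
        · exact mul_le_mul_right (lintegral_enorm_sub_ballUniform_le hf _ _) _
        · exact mul_le_mul_right (lintegral_enorm_sub_ballUniform_le hf _ _) _
    _ = _ := by
        rw [← mul_add, ← mul_add, ← mul_assoc]
        congr 1
        rw [show (2 : ℝ) ^ (n + 1) * t = 2 ^ n * (2 * t) by ring,
          ENNReal.ofReal_mul (p := 2 ^ n) (by positivity), ENNReal.ofReal_pow (by norm_num),
          ENNReal.ofReal_ofNat]

theorem lintegral_enorm_sub_rpow_le {f : EuclideanSpace ℝ (Fin n) → ℝ} (hf : ContDiff ℝ 1 f)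
    {t : ℝ} (ht : 0 < t) {h : EuclideanSpace ℝ (Fin n)} (hh : h ∈ Metric.ball 0 t) {p : ℝ}
    (hp : 1 ≤ p) :
    ∫⁻ x, ‖f (x + h) - f x‖ₑ ^ p ≤ ENNReal.ofReal (2 ^ (n + 2) * t) ^ p *
      ∫⁻ x, segmentAverage (2 * t) (fun y => ‖fderiv ℝ f y‖ₑ) x ^ p := by
  have hG := measurable_enorm_fderiv hf
  set N := segmentAverage (2 * t) (fun y => ‖fderiv ℝ f y‖ₑ) with hN
  have hNm : Measurable N := measurable_segmentAverage _ hG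
  have hp0 : 0 ≤ p := by linarith
  calc _ ≤ ∫⁻ x, ENNReal.ofReal (2 ^ (n + 1) * t) ^ p *
        (2 ^ (p - 1) * (N (x + h) ^ p + N x ^ p)) := by
        refine lintegral_mono fun x => ?_
        refine (ENNReal.rpow_le_rpow (enorm_sub_le_segmentAverage hf ht hh x) hp0).trans ?_
        rw [ENNReal.mul_rpow_of_nonneg _ _ hp0]
        gcongr
        exact ENNReal.rpow_add_le_mul_rpow_add_rpow _ _ hp
    _ = ENNReal.ofReal (2 ^ (n + 1) * t) ^ p * (2 ^ (p - 1) * (2 * ∫⁻ x, N x ^ p)) := by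
        rw [lintegral_const_mul _ (by fun_prop), lintegral_const_mul _ (by fun_prop),
          lintegral_add_right _ (by fun_prop), lintegral_add_right_eq_self (fun x => N x ^ p) h,
          two_mul]
    _ = _ := by
        have h2 : (2 : ℝ≥0∞) ^ (p - 1) * 2 = 2 ^ p := by
          conv_lhs => rw [← ENNReal.rpow_one 2, ← ENNReal.rpow_mul, one_mul]
          rw [← ENNReal.rpow_add _ _ (by norm_num) (by norm_num), sub_add_cancel]
        rw [← mul_assoc (2 ^ (p - 1)), h2, ← mul_assoc, ← ENNReal.mul_rpow_of_nonneg _ _ hp0]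
        congr 2
        rw [show (2 : ℝ) ^ (n + 2) * t = 2 ^ (n + 1) * t * 2 by ring,
          ENNReal.ofReal_mul (q := 2) (by positivity), ENNReal.ofReal_ofNat]

theorem eLpNorm_ofReal_rpow {E F : Type*} [MeasurableSpace E] [NormedAddCommGroup F]
    {μ : Measure E} (f : E → F) {p : ℝ} (hp : 0 < p) :
    eLpNorm f (ENNReal.ofReal p) μ ^ p = ∫⁻ x, ‖f x‖ₑ ^ p ∂μ := by
  rw [eLpNorm_eq_lintegral_rpow_enorm_toReal (by simpa using hp) ENNReal.ofReal_ne_top,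
    ENNReal.toReal_ofReal hp.le, ← ENNReal.rpow_mul, one_div_mul_cancel hp.ne', ENNReal.rpow_one]

theorem smoothnessModulus_le_segmentAverage {f : EuclideanSpace ℝ (Fin n) → ℝ}
    (hf : ContDiff ℝ 1 f) {t : ℝ} (ht : 0 < t) {p : ℝ} (hp : 1 ≤ p) :
    smoothnessModulus f p t ≤ ENNReal.ofReal (2 ^ (n + 2) * t) *
      (∫⁻ x, segmentAverage (2 * t) (fun y => ‖fderiv ℝ f y‖ₑ) x ^ p) ^ (1 / p) := by
  have hp0 : 0 < p := by linarith
  set K := ENNReal.ofReal (2 ^ (n + 2) * t) ^ p *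
      ∫⁻ x, segmentAverage (2 * t) (fun y => ‖fderiv ℝ f y‖ₑ) x ^ p with hK
  have h1 : ∫⁻ h in Metric.ball (0 : EuclideanSpace ℝ (Fin n)) t,
      eLpNorm (fun x => f (x + h) - f x) (ENNReal.ofReal p) volume ^ p ≤
      K * volume (Metric.ball (0 : EuclideanSpace ℝ (Fin n)) t) := by
    rw [← setLIntegral_const]
    refine setLIntegral_mono' Metric.isOpen_ball.measurableSet fun h hh => ?_
    rw [eLpNorm_ofReal_rpow _ hp0]
    exact lintegral_enorm_sub_rpow_le hf ht hh hp
  rw [smoothnessModulus, ← volume_ball_euclideanSpace ht]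
  calc _ ≤ ((volume (Metric.ball (0 : EuclideanSpace ℝ (Fin n)) t))⁻¹ *
        (K * volume (Metric.ball (0 : EuclideanSpace ℝ (Fin n)) t))) ^ (1 / p) := by gcongr
    _ = K ^ (1 / p) := by
        rw [mul_left_comm, ENNReal.inv_mul_cancel (Metric.measure_ball_pos _ _ ht).ne'
          measure_ball_lt_top.ne, mul_one]
    _ = _ := by
        rw [hK, ENNReal.mul_rpow_of_nonneg _ _ (by positivity), ← ENNReal.rpow_mul,
          mul_one_div_cancel hp0.ne', ENNReal.rpow_one]

end Smooth

/-! ### The embedding for `C¹` functions -/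

section SmoothEmbedding

variable {n : ℕ}

/-- Estimate `segmentAverage T G` in `L^p` by cutting `G` along `S`: the smoothing bound is applied to
the part on `S`, and `L^p` contractivity to the remaining part. -/
theorem rpow_lintegral_segmentAverage_le {T : ℝ} (hT : 0 < T)
    {G : EuclideanSpace ℝ (Fin n) → ℝ≥0∞} (hG : Measurable G) {r p P : ℝ} (hr : 1 ≤ r)
    (hrp : r ≤ p) (hpP : p ≤ P) (hexp : n * (p - r) / r ≤ p - 1) (hnp : n ≤ p)
    {S : Set (EuclideanSpace ℝ (Fin n))} (hS : MeasurableSet S) :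
    (∫⁻ x, segmentAverage T G x ^ p) ^ (n / p : ℝ) ≤ 2 ^ n * (ENNReal.ofReal (4 * P) ^ n *
      ((volume (Metric.ball (0 : EuclideanSpace ℝ (Fin n)) T)) ^ (-(n / r - n / p : ℝ)) *
        (∫⁻ x in S, G x ^ r) ^ (n / r : ℝ)) + (∫⁻ x in Sᶜ, G x ^ p) ^ (n / p : ℝ)) := by
  have hp : 1 ≤ p := hr.trans hrp
  have hp0 : 0 < p := by linarith
  have hr0 : 0 < r := by linarith
  have hα0 : (0 : ℝ) ≤ n / p := by positivity
  have hα1 : (n / p : ℝ) ≤ 1 := (div_le_one hp0).2 hnp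
  set N₁ := segmentAverage T (S.indicator G) with hN₁
  set N₂ := segmentAverage T (Sᶜ.indicator G) with hN₂
  have hm₁ : Measurable N₁ := measurable_segmentAverage T (hG.indicator hS)
  have hind : ∀ (A : Set (EuclideanSpace ℝ (Fin n))) (_ : MeasurableSet A) (q : ℝ), 0 < q →
      ∫⁻ x, A.indicator G x ^ q = ∫⁻ x in A, G x ^ q := by
    intro A hA q hq
    rw [← lintegral_indicator hA]
    refine lintegral_congr fun x => ?_
    by_cases hx : x ∈ A
    · simp [hx]
    · simp [hx, hq]
  have hsplit : segmentAverage T G = fun x => N₁ x + N₂ x := by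
    ext x
    rw [hN₁, hN₂, ← segmentAverage_add T (hG.indicator hS)]
    congr 1
    ext y
    by_cases hy : y ∈ S <;> simp [hy]
  have h1 : ∫⁻ x, segmentAverage T G x ^ p ≤ 2 ^ p * ((∫⁻ x, N₁ x ^ p) + ∫⁻ x, N₂ x ^ p) := by
    rw [hsplit]
    calc _ ≤ ∫⁻ x, 2 ^ p * (N₁ x ^ p + N₂ x ^ p) := by
          refine lintegral_mono fun x => (ENNReal.rpow_add_le_mul_rpow_add_rpow _ _ hp).trans ?_
          gcongr
          · norm_num
          · linarith
      _ = _ := by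
          rw [lintegral_const_mul' _ _ (by simp), lintegral_add_left (hm₁.pow_const p)]
  have h2 : (∫⁻ x, N₁ x ^ p) ^ (n / p : ℝ) ≤ ENNReal.ofReal (4 * P) ^ n *
      ((volume (Metric.ball (0 : EuclideanSpace ℝ (Fin n)) T)) ^ (-(n / r - n / p : ℝ)) *
        (∫⁻ x in S, G x ^ r) ^ (n / r : ℝ)) := by
    have := ENNReal.rpow_le_rpow
      (lintegral_segmentAverage_rpow_le_of_lt hT (hG.indicator hS) hr hrp hpP hexp) hα0
    refine this.trans (le_of_eq ?_)
    rw [ENNReal.mul_rpow_of_nonneg _ _ hα0, ENNReal.mul_rpow_of_nonneg _ _ hα0,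
      ← ENNReal.rpow_mul, ← ENNReal.rpow_mul, ← ENNReal.rpow_mul, hind S hS r hr0,
      mul_div_cancel₀ _ hp0.ne', ENNReal.rpow_natCast, ENNReal.inv_rpow, ← ENNReal.rpow_neg]
    congr 3
    · field_simp
    · field_simp
  have h3 : ∫⁻ x, N₂ x ^ p ≤ ∫⁻ x in Sᶜ, G x ^ p := by
    rw [← hind Sᶜ hS.compl p hp0]
    exact lintegral_segmentAverage_rpow_le hT (hG.indicator hS.compl) hp
  calc _ ≤ (2 ^ p * ((∫⁻ x, N₁ x ^ p) + ∫⁻ x, N₂ x ^ p)) ^ (n / p : ℝ) :=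
        ENNReal.rpow_le_rpow h1 hα0
    _ ≤ 2 ^ n * ((∫⁻ x, N₁ x ^ p) ^ (n / p : ℝ) + (∫⁻ x, N₂ x ^ p) ^ (n / p : ℝ)) := by
        rw [ENNReal.mul_rpow_of_nonneg _ _ hα0, ← ENNReal.rpow_mul, mul_div_cancel₀ _ hp0.ne',
          ENNReal.rpow_natCast]
        gcongr
        exact ENNReal.rpow_add_le_add_rpow _ _ hα0 hα1
    _ ≤ _ := by
        gcongr

/-- The embedding estimate for `C¹` functions, raised to the power `n`. -/
theorem exists_besovNorm_rpow_le_of_contDiff (hn : 2 ≤ n) {P : ℝ} (hP : n < P) :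
    ∃ C : ℝ, 0 < C ∧ ∀ p : ℝ, n < p → p ≤ P → ∀ f : EuclideanSpace ℝ (Fin n) → ℝ,
      ContDiff ℝ 1 f → besovNorm (n / p) p n f ^ (n : ℝ) ≤
        ENNReal.ofReal (C * (1 - n / p)⁻¹) * ∫⁻ x, ‖fderiv ℝ f x‖ₑ ^ (n : ℝ) := by
  have hn0 : (0 : ℝ) < n := by positivity
  have hn2 : (2 : ℝ) ≤ n := by exact_mod_cast hn
  have hP0 : 0 < P := hn0.trans hP
  -- the auxiliary exponent `r < n` with `1 / r = 1 / n + 1 / (2 P)`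
  set ρ : ℝ := 1 + n / (2 * P) with hρdef
  have hρ1 : 1 < ρ := by rw [hρdef]; linarith [show 0 < n / (2 * P) by positivity]
  have hρ2 : ρ ≤ 2 := by
    have : n / (2 * P) ≤ 1 := (div_le_one (by positivity)).2 (by linarith)
    linarith
  set r : ℝ := n / ρ with hrdef
  have hr1 : 1 ≤ r := (one_le_div (by linarith)).2 (by linarith)
  have hr0 : 0 < r := by linarith
  have hrn : r ≤ n := div_le_self hn0.le hρ1.le
  have hnr : n / r = ρ := by rw [hrdef]; field_simp
  set b : ℝ≥0∞ := volume (Metric.ball (0 : EuclideanSpace ℝ (Fin n)) 1) with hb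
  have hbtop : b ≠ ⊤ := measure_ball_lt_top.ne
  have hb0 : b ≠ 0 := (Metric.measure_ball_pos _ _ one_pos).ne'
  have hbr : 0 < b.toReal := ENNReal.toReal_pos hb0 hbtop
  set κ : ℝ := 2 ^ n * b.toReal with hκdef
  have hκ : 0 < κ := by positivity
  have hvol : ∀ t : ℝ, 0 < t → volume (Metric.ball (0 : EuclideanSpace ℝ (Fin n)) (2 * t)) =
      ENNReal.ofReal (κ * t ^ n) := by
    intro t ht
    rw [volume_ball_euclideanSpace (by positivity), ← hb, hκdef,
      show 2 ^ n * b.toReal * t ^ n = (2 * t) ^ n * b.toReal by rw [mul_pow]; ring,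
      ENNReal.ofReal_mul (by positivity), ENNReal.ofReal_toReal hbtop]
  set A : ℝ := (4 * P) ^ n with hA
  have hA0 : 0 < A := by positivity
  -- `1 + κ⁻¹` bounds `κ ^ (-(1 - n / p))` for every `p > n`
  set c : ℝ := (2 ^ (n + 2)) ^ n * 2 ^ n * (1 + κ⁻¹) with hc
  have hc0 : 0 < c := by positivity
  refine ⟨c * (1 / n) * (A * (2 ^ ρ / (ρ - 1)) + 2 ^ (n + 1)), ?_, ?_⟩
  · have : 0 < ρ - 1 := by linarith
    positivity
  intro p hnp hpP f hf
  have hp0 : 0 < p := hn0.trans hnp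
  have hp1 : 1 < p := by linarith
  set α : ℝ := n / p with hα
  have hα0 : 0 < α := by positivity
  have hα1 : α < 1 := (div_lt_one hp0).2 hnp
  have hpα : p * α = n := by rw [hα]; field_simp
  have hexp : n * (p - r) / r ≤ p - 1 := by
    have e : n * (p - r) / r = p * (n / r) - n := by field_simp
    rw [e, hnr, hρdef]
    have : p * (n / (2 * P)) ≤ n / 2 := by
      rw [mul_div_assoc', div_le_div_iff₀ (by positivity) (by positivity)]
      nlinarith
    linarith
  set G : EuclideanSpace ℝ (Fin n) → ℝ≥0∞ := fun x => ‖fderiv ℝ f x‖ₑ with hGdef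
  have hG : Measurable G := measurable_enorm_fderiv hf
  have hGfin : ∀ x, G x ≠ ⊤ := fun x => enorm_ne_top
  set V := superlevelRank (volume : Measure (EuclideanSpace ℝ (Fin n))) G with hV
  have hVm : Measurable V := measurable_superlevelRank hG
  set L : ℝ → ℝ≥0∞ := fun v => (∫⁻ x in {x | V x ≤ ENNReal.ofReal v}, G x ^ r) ^ ρ with hL
  set H : ℝ → ℝ≥0∞ := fun v => (∫⁻ x in {x | ENNReal.ofReal v < V x}, G x ^ p) ^ α with hH
  set F : ℝ → ℝ≥0∞ := fun v => ENNReal.ofReal (v ^ (1 - α)) *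
    (ENNReal.ofReal A * (ENNReal.ofReal v ^ (-(ρ - α)) * L v) + H v) with hF
  have hpt : ∀ t ∈ Ioi (0 : ℝ), ENNReal.ofReal (t ^ (-(α * n))) *
      smoothnessModulus f p t ^ (n : ℝ) * ENNReal.ofReal (1 / t) ≤
      ENNReal.ofReal c * (F (κ * t ^ n) * ENNReal.ofReal (1 / t)) := by
    intro t ht
    have ht0 : (0 : ℝ) < t := ht
    have h1 := ENNReal.rpow_le_rpow (smoothnessModulus_le_segmentAverage hf ht0 hp1.le) hn0.le
    rw [ENNReal.mul_rpow_of_nonneg _ _ hn0.le, ← ENNReal.rpow_mul, one_div_mul_eq_div,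
      ENNReal.ofReal_rpow_of_pos (by positivity)] at h1
    have h2 := rpow_lintegral_segmentAverage_le (T := 2 * t) (by positivity) hG hr1
      (hrn.trans hnp.le) hpP hexp hnp.le
      (S := {x | V x ≤ ENNReal.ofReal (κ * t ^ n)}) (measurableSet_le hVm measurable_const)
    have hcompl : {x | V x ≤ ENNReal.ofReal (κ * t ^ n)}ᶜ =
        {x | ENNReal.ofReal (κ * t ^ n) < V x} := by
      ext x
      simp
    rw [hcompl, hnr, hvol t ht0, ← ENNReal.ofReal_pow (by positivity)] at h2
    rw [← mul_assoc]
    gcongr ?_ * _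
    refine (mul_le_mul_right (h1.trans (mul_le_mul_right h2 _)) _).trans ?_
    rw [← mul_assoc, ← mul_assoc, ← ENNReal.ofReal_mul (by positivity)]
    have hR : ENNReal.ofReal A * (ENNReal.ofReal (κ * t ^ n) ^ (-(ρ - α)) * L (κ * t ^ n)) +
        H (κ * t ^ n) = ENNReal.ofReal A * (ENNReal.ofReal (κ * t ^ n) ^ (-(ρ - α)) *
        (∫⁻ x in {x | V x ≤ ENNReal.ofReal (κ * t ^ n)}, G x ^ r) ^ ρ) +
        (∫⁻ x in {x | ENNReal.ofReal (κ * t ^ n) < V x}, G x ^ p) ^ α := rfl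
    simp only [hF]
    rw [hR, ← mul_assoc (ENNReal.ofReal c), ← ENNReal.ofReal_mul hc0.le,
      show (2 : ℝ≥0∞) ^ n = ENNReal.ofReal (2 ^ n) by
        rw [ENNReal.ofReal_pow (by norm_num), ENNReal.ofReal_ofNat],
      ← ENNReal.ofReal_mul (by positivity)]
    gcongr ENNReal.ofReal ?_ * _
    rw [Real.mul_rpow (by positivity) (by positivity), Real.rpow_natCast,
      Real.mul_rpow hκ.le (by positivity), ← Real.rpow_natCast t n, ← Real.rpow_mul ht0.le]
    have e1 : t ^ (n : ℝ) = t ^ (α * n) * t ^ (n * (1 - α)) := by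
      rw [← Real.rpow_add ht0]; ring_nf
    have e2 : t ^ (-(α * n)) * t ^ (α * n) = 1 := by
      rw [← Real.rpow_add ht0]; simp
    have e3 : 1 ≤ (1 + κ⁻¹) * κ ^ (1 - α) := by
      have : (κ⁻¹) ^ (1 - α) ≤ 1 + κ⁻¹ := by
        calc (κ⁻¹) ^ (1 - α) ≤ (1 + κ⁻¹) ^ (1 - α) :=
              Real.rpow_le_rpow (by positivity) (by linarith) (by linarith)
          _ ≤ (1 + κ⁻¹) ^ (1 : ℝ) := Real.rpow_le_rpow_of_exponent_le
              (by linarith [inv_pos.2 hκ]) (by linarith)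
          _ = _ := Real.rpow_one _
      calc (1 : ℝ) = (κ⁻¹) ^ (1 - α) * κ ^ (1 - α) := by
            rw [← Real.mul_rpow (by positivity) hκ.le, inv_mul_cancel₀ hκ.ne', Real.one_rpow]
        _ ≤ _ := by gcongr
    calc t ^ (-(α * n)) * ((2 ^ (n + 2)) ^ n * t ^ (n : ℝ)) * 2 ^ n
        = (t ^ (-(α * n)) * t ^ (α * n)) * ((2 ^ (n + 2)) ^ n * 2 ^ n * t ^ (n * (1 - α))) := by
          rw [e1]; ring
      _ = (2 ^ (n + 2)) ^ n * 2 ^ n * t ^ (n * (1 - α)) * 1 := by rw [e2]; ring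
      _ ≤ (2 ^ (n + 2)) ^ n * 2 ^ n * t ^ (n * (1 - α)) * ((1 + κ⁻¹) * κ ^ (1 - α)) := by gcongr
      _ = _ := by rw [hc]; ring
  have hLm : Measurable L := by
    have : Monotone L := by
      intro v w hvw
      simp only [hL]
      gcongr
    exact this.measurable
  have hF2 : ∀ v ∈ Ioi (0 : ℝ), F v * ENNReal.ofReal (1 / v) =
      ENNReal.ofReal A * (ENNReal.ofReal (v ^ (-ρ)) * L v) +
        ENNReal.ofReal (v ^ (-α)) * H v := by
    intro v hv
    have hv0 : (0 : ℝ) < v := hv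
    have e1 : ENNReal.ofReal (v ^ (1 - α)) * ENNReal.ofReal (1 / v) =
        ENNReal.ofReal (v ^ (-α)) := by
      rw [← ENNReal.ofReal_mul (by positivity), one_div, ← Real.rpow_neg_one,
        ← Real.rpow_add hv0]
      ring_nf
    have e2 : ENNReal.ofReal (v ^ (-α)) * ENNReal.ofReal v ^ (-(ρ - α)) =
        ENNReal.ofReal (v ^ (-ρ)) := by
      rw [ENNReal.ofReal_rpow_of_pos hv0, ← ENNReal.ofReal_mul (by positivity),
        ← Real.rpow_add hv0]
      ring_nf
    calc F v * ENNReal.ofReal (1 / v) = (ENNReal.ofReal (v ^ (1 - α)) * ENNReal.ofReal (1 / v)) *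
          (ENNReal.ofReal A * (ENNReal.ofReal v ^ (-(ρ - α)) * L v) + H v) := by
          simp only [hF]; ring
      _ = ENNReal.ofReal A * ((ENNReal.ofReal (v ^ (-α)) * ENNReal.ofReal v ^ (-(ρ - α))) * L v) +
          ENNReal.ofReal (v ^ (-α)) * H v := by rw [e1]; ring
      _ = _ := by rw [e2]
  have hlow := hardy_superlevelRank (μ := volume) hVm measure_superlevelRank_le
    (hG.pow_const r) hρ1
  have hGr : ∀ x, (G x ^ r) ^ ρ = G x ^ (n : ℝ) := by
    intro x
    rw [← ENNReal.rpow_mul, hrdef, div_mul_cancel₀ _ (by linarith)]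
  simp_rw [hGr] at hlow
  have hhigh := lintegral_lt_superlevelRank_rpow_le (μ := volume) hG hGfin hp0 hα0 hα1
    (by rw [hpα]; linarith)
  rw [hpα] at hhigh
  set I := ∫⁻ x, G x ^ (n : ℝ) with hI
  rw [besovNorm, ← ENNReal.rpow_mul, one_div_mul_cancel hn0.ne', ENNReal.rpow_one]
  have h1α : 1 ≤ (1 - α)⁻¹ := (one_le_inv₀ (by linarith)).2 (by linarith)
  calc _ ≤ ∫⁻ t in Ioi (0 : ℝ), ENNReal.ofReal c * (F (κ * t ^ n) * ENNReal.ofReal (1 / t)) :=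
        setLIntegral_mono' measurableSet_Ioi hpt
    _ = ENNReal.ofReal c * (ENNReal.ofReal (1 / n) *
          (ENNReal.ofReal A * (∫⁻ v in Ioi (0 : ℝ), ENNReal.ofReal (v ^ (-ρ)) * L v) +
            ∫⁻ v in Ioi (0 : ℝ), ENNReal.ofReal (v ^ (-α)) * H v)) := by
        rw [lintegral_const_mul' _ _ ENNReal.ofReal_ne_top,
          lintegral_Ioi_comp_mul_pow (by omega) hκ, setLIntegral_congr_fun measurableSet_Ioi hF2,
          lintegral_add_left (by fun_prop), lintegral_const_mul' _ _ ENNReal.ofReal_ne_top]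
    _ ≤ ENNReal.ofReal c * (ENNReal.ofReal (1 / n) *
          (ENNReal.ofReal A * (ENNReal.ofReal (2 ^ ρ / (ρ - 1)) * I) +
            ENNReal.ofReal (1 / (1 - α)) * (2 ^ ((n : ℝ) + 1) * I))) := by
        gcongr
    _ = ENNReal.ofReal (c * (1 / n) * (A * (2 ^ ρ / (ρ - 1)) +
          (1 - α)⁻¹ * 2 ^ (n + 1))) * I := by
        have : (2 : ℝ≥0∞) ^ ((n : ℝ) + 1) = ENNReal.ofReal (2 ^ (n + 1)) := by
          rw [ENNReal.ofReal_pow (by norm_num), ENNReal.ofReal_ofNat, ← ENNReal.rpow_natCast]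
          push_cast
          rfl
        have hρ0 : 0 < ρ - 1 := by linarith
        rw [this, ENNReal.ofReal_mul (p := c * (1 / n)) (by positivity),
          ENNReal.ofReal_mul (p := c) (by positivity),
          ENNReal.ofReal_add (by positivity) (by positivity),
          ENNReal.ofReal_mul (p := A) (by positivity),
          ENNReal.ofReal_mul (p := (1 - α)⁻¹) (by positivity), one_div (1 - α)]
        ring
    _ ≤ _ := by
        have hρ0 : 0 < ρ - 1 := by linarith
        gcongr ENNReal.ofReal ?_ * _
        rw [mul_assoc (c * (1 / n))]
        gcongr c * (1 / n) * ?_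
        have : A * (2 ^ ρ / (ρ - 1)) * 1 ≤ A * (2 ^ ρ / (ρ - 1)) * (1 - α)⁻¹ := by gcongr
        linarith

end SmoothEmbedding

/-! ### Passage to weakly differentiable functions -/

section Semicontinuity

open Filter Topology

variable {n : ℕ}

theorem measurable_smoothnessModulus (f : EuclideanSpace ℝ (Fin n) → ℝ) (p : ℝ) :
    Measurable (smoothnessModulus f p) := by
  have hmono : Monotone fun t : ℝ => ∫⁻ h in Metric.ball (0 : EuclideanSpace ℝ (Fin n)) t,
      eLpNorm (fun x => f (x + h) - f x) (ENNReal.ofReal p) volume ^ p :=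
    fun s t hst => lintegral_mono_set (Metric.ball_subset_ball hst)
  have := hmono.measurable
  unfold smoothnessModulus
  fun_prop

theorem besovNorm_rpow {s p q : ℝ} (hq : 0 < q) (f : EuclideanSpace ℝ (Fin n) → ℝ) :
    besovNorm s p q f ^ q = ∫⁻ t in Ioi (0 : ℝ),
      ENNReal.ofReal (t ^ (-(s * q))) * smoothnessModulus f p t ^ q * ENNReal.ofReal (1 / t) := by
  rw [besovNorm, ← ENNReal.rpow_mul, one_div_mul_cancel hq.ne', ENNReal.rpow_one]

theorem monotone_map_liminf_of_continuous {φ : ℝ≥0∞ → ℝ≥0∞} (hφ : Monotone φ)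
    (hc : Continuous φ) (a : ℕ → ℝ≥0∞) :
    φ (liminf a atTop) = liminf (fun k => φ (a k)) atTop :=
  hφ.map_liminf_of_continuousAt a hc.continuousAt
    (isBoundedUnder_of ⟨⊤, fun _ => le_top⟩).isCoboundedUnder_ge
    (isBoundedUnder_of ⟨0, fun _ => zero_le⟩)

theorem smoothnessModulus_le_liminf {f : EuclideanSpace ℝ (Fin n) → ℝ}
    {F : ℕ → EuclideanSpace ℝ (Fin n) → ℝ} (hF : ∀ k, Measurable (F k))
    (hlim : ∀ᵐ x, Tendsto (fun k => F k x) atTop (𝓝 (f x))) {p : ℝ} (hp : 0 < p) {t : ℝ}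
    (ht : 0 < t) :
    smoothnessModulus f p t ≤ liminf (fun k => smoothnessModulus (F k) p t) atTop := by
  have hpt : ∀ h : EuclideanSpace ℝ (Fin n),
      eLpNorm (fun x => f (x + h) - f x) (ENNReal.ofReal p) volume ^ p ≤
      liminf (fun k => ∫⁻ x, ‖F k (x + h) - F k x‖ₑ ^ p) atTop := by
    intro h
    rw [eLpNorm_ofReal_rpow _ hp]
    have hlim2 := (measurePreserving_add_right volume h).quasiMeasurePreserving.ae hlim
    calc _ ≤ ∫⁻ x, liminf (fun k => ‖F k (x + h) - F k x‖ₑ ^ p) atTop := by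
          refine lintegral_mono_ae ?_
          filter_upwards [hlim, hlim2] with x h1 h2
          refine le_of_eq (Tendsto.liminf_eq ?_).symm
          exact (ENNReal.continuous_rpow_const.tendsto _).comp
            ((continuous_enorm.tendsto _).comp (h2.sub h1))
      _ ≤ _ := lintegral_liminf_le fun k => by
          have := hF k
          fun_prop
  have hle : ∫⁻ h in Metric.ball (0 : EuclideanSpace ℝ (Fin n)) t,
      eLpNorm (fun x => f (x + h) - f x) (ENNReal.ofReal p) volume ^ p ≤
      liminf (fun k => ∫⁻ h in Metric.ball (0 : EuclideanSpace ℝ (Fin n)) t,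
        ∫⁻ x, ‖F k (x + h) - F k x‖ₑ ^ p) atTop := by
    refine (lintegral_mono fun h => hpt h).trans (lintegral_liminf_le fun k => ?_)
    have := hF k
    exact Measurable.lintegral_prod_right' (f := fun q : EuclideanSpace ℝ (Fin n) ×
      EuclideanSpace ℝ (Fin n) => ‖F k (q.2 + q.1) - F k q.2‖ₑ ^ p) (by fun_prop)
  simp only [smoothnessModulus, eLpNorm_ofReal_rpow _ hp] at hle ⊢
  rw [← volume_ball_euclideanSpace ht]
  set c := (volume (Metric.ball (0 : EuclideanSpace ℝ (Fin n)) t))⁻¹ with hc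
  have hct : c ≠ ⊤ := ENNReal.inv_ne_top.2 (Metric.measure_ball_pos _ _ ht).ne'
  rw [← monotone_map_liminf_of_continuous (φ := fun y => (c * y) ^ (1 / p))]
  · gcongr
  · intro y z hyz
    dsimp only
    gcongr
  · exact ENNReal.continuous_rpow_const.comp (ENNReal.continuous_const_mul hct)

/-- Fatou's lemma for the Besov norm. -/
theorem besovNorm_rpow_le_of_tendsto {f : EuclideanSpace ℝ (Fin n) → ℝ}
    {F : ℕ → EuclideanSpace ℝ (Fin n) → ℝ} (hF : ∀ k, Measurable (F k))
    (hlim : ∀ᵐ x, Tendsto (fun k => F k x) atTop (𝓝 (f x))) {s p q : ℝ} (hp : 0 < p) (hq : 0 < q)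
    {M : ℝ≥0∞} (hM : ∀ k, besovNorm s p q (F k) ^ q ≤ M) : besovNorm s p q f ^ q ≤ M := by
  simp_rw [besovNorm_rpow hq] at hM ⊢
  have hpt : ∀ t ∈ Ioi (0 : ℝ),
      ENNReal.ofReal (t ^ (-(s * q))) * smoothnessModulus f p t ^ q * ENNReal.ofReal (1 / t) ≤
      liminf (fun k => ENNReal.ofReal (t ^ (-(s * q))) * smoothnessModulus (F k) p t ^ q *
        ENNReal.ofReal (1 / t)) atTop := by
    intro t ht
    rw [← monotone_map_liminf_of_continuous
      (φ := fun y => ENNReal.ofReal (t ^ (-(s * q))) * y ^ q * ENNReal.ofReal (1 / t))]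
    · gcongr
      exact smoothnessModulus_le_liminf hF hlim hp ht
    · intro y z hyz
      dsimp only
      gcongr
    · exact (ENNReal.continuous_mul_const ENNReal.ofReal_ne_top).comp
        ((ENNReal.continuous_const_mul ENNReal.ofReal_ne_top).comp ENNReal.continuous_rpow_const)
  refine (setLIntegral_mono' measurableSet_Ioi hpt).trans ((lintegral_liminf_le fun k => ?_).trans ?_)
  · have := measurable_smoothnessModulus (F k) p
    fun_prop
  · exact liminf_le_of_frequently_le' (Frequently.of_forall hM)

end Semicontinuity

section Mollification

open Filter Topology
open scoped Convolution

variable {n : ℕ}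

theorem fderiv_mollification_apply {f : EuclideanSpace ℝ (Fin n) → ℝ}
    {g : EuclideanSpace ℝ (Fin n) → EuclideanSpace ℝ (Fin n)} (hfg : IsWeakGradient f g)
    {φ : EuclideanSpace ℝ (Fin n) → ℝ} (hφ : ContDiff ℝ ∞ φ) (hc : HasCompactSupport φ)
    (x v : EuclideanSpace ℝ (Fin n)) :
    fderiv ℝ (φ ⋆[ContinuousLinearMap.lsmul ℝ ℝ, volume] f) x v =
      ∫ y, inner ℝ (g y) v * φ (x - y) := by
  have hφ1 : ContDiff ℝ 1 φ := hφ.of_le (by exact_mod_cast le_top)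
  have hd := hc.hasFDerivAt_convolution_left (ContinuousLinearMap.lsmul ℝ ℝ) hφ1
    hfg.locallyIntegrable_fun x
  have hex := (hc.fderiv ℝ).convolutionExists_left
    ((ContinuousLinearMap.lsmul ℝ ℝ).precompL (EuclideanSpace ℝ (Fin n)))
    (hφ1.continuous_fderiv one_ne_zero) hfg.locallyIntegrable_fun x
  have hψ : ContDiff ℝ ∞ fun y => φ (x - y) := hφ.comp (contDiff_const.sub contDiff_id)
  have hψc : HasCompactSupport fun y => φ (x - y) :=
    hc.comp_homeomorph (Homeomorph.subLeft x)
  have hψd : ∀ y, fderiv ℝ (fun y => φ (x - y)) y v = - fderiv ℝ φ (x - y) v := by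
    intro y
    have h1 : HasFDerivAt (fun y => x - y)
        (-(ContinuousLinearMap.id ℝ (EuclideanSpace ℝ (Fin n)))) y := by
      simpa using (hasFDerivAt_id y).const_sub x
    have h2 := (hφ1.differentiable one_ne_zero (x - y)).hasFDerivAt.comp y h1
    have h3 : HasFDerivAt (fun y => φ (x - y)) _ y := h2
    rw [h3.fderiv]
    simp
  have h := hfg.integral_eq _ hψ hψc v
  simp_rw [hψd, mul_neg, integral_neg] at h
  rw [← neg_inj.1 h, hd.fderiv, convolution_def, ContinuousLinearMap.integral_apply hex,
    ← integral_sub_left_eq_self _ volume x]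
  refine integral_congr_ae (ae_of_all _ fun y => ?_)
  simp [ContinuousLinearMap.precompL_apply, mul_comm]

/-- The gradient of a mollification is the mollification of the weak gradient; only the resulting
bound on its length is recorded. -/
theorem enorm_fderiv_mollification_le {f : EuclideanSpace ℝ (Fin n) → ℝ}
    {g : EuclideanSpace ℝ (Fin n) → EuclideanSpace ℝ (Fin n)} (hfg : IsWeakGradient f g)
    {φ : EuclideanSpace ℝ (Fin n) → ℝ} (hφ : ContDiff ℝ ∞ φ) (hc : HasCompactSupport φ)
    (x : EuclideanSpace ℝ (Fin n)) :
    ‖fderiv ℝ (φ ⋆[ContinuousLinearMap.lsmul ℝ ℝ, volume] f) x‖ₑ ≤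
      ∫⁻ y, ‖φ y‖ₑ * ‖g (x - y)‖ₑ := by
  refine ContinuousLinearMap.opENorm_le_bound _ fun v => ?_
  rw [fderiv_mollification_apply hfg hφ hc, ← integral_sub_left_eq_self _ volume x,
    ← lintegral_mul_const' _ _ enorm_ne_top]
  refine (enorm_integral_le_lintegral_enorm _).trans (lintegral_mono fun y => ?_)
  rw [sub_sub_cancel, enorm_mul, mul_comm, mul_assoc]
  gcongr
  rw [← enorm_norm (g (x - y)), ← enorm_norm v, ← enorm_mul, Real.enorm_eq_ofReal_abs,
    Real.enorm_eq_ofReal_abs, abs_mul, abs_norm, abs_norm]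
  exact ENNReal.ofReal_le_ofReal (abs_real_inner_le_norm _ _)

theorem lintegral_enorm_fderiv_mollification_rpow_le {f : EuclideanSpace ℝ (Fin n) → ℝ}
    {g : EuclideanSpace ℝ (Fin n) → EuclideanSpace ℝ (Fin n)} (hfg : IsWeakGradient f g)
    {φ : EuclideanSpace ℝ (Fin n) → ℝ} (hφ : ContDiff ℝ ∞ φ) (hc : HasCompactSupport φ)
    (hφ1 : ∫⁻ y, ‖φ y‖ₑ ≤ 1) {q : ℝ} (hq : 1 ≤ q) :
    ∫⁻ x, ‖fderiv ℝ (φ ⋆[ContinuousLinearMap.lsmul ℝ ℝ, volume] f) x‖ₑ ^ q ≤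
      ∫⁻ x, ‖g x‖ₑ ^ q := by
  have hq0 : 0 ≤ q := by linarith
  have hφm : Measurable fun y => ‖φ y‖ₑ := hφ.continuous.enorm.measurable
  obtain ⟨γ, hγm, hγ⟩ := hfg.locallyIntegrable_grad.aestronglyMeasurable.enorm
  set ν : Measure (EuclideanSpace ℝ (Fin n)) := volume.withDensity fun y => ‖φ y‖ₑ with hν
  have hν1 : ν univ ≤ 1 := by
    rw [hν, withDensity_apply _ MeasurableSet.univ, Measure.restrict_univ]
    exact hφ1
  have : IsFiniteMeasure ν := ⟨hν1.trans_lt ENNReal.one_lt_top⟩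
  have hpt : ∀ x, ‖fderiv ℝ (φ ⋆[ContinuousLinearMap.lsmul ℝ ℝ, volume] f) x‖ₑ ^ q ≤
      ∫⁻ y, γ (x - y) ^ q ∂ν := by
    intro x
    refine le_trans ?_ (lintegral_rpow_le_lintegral_rpow hν1 hq (F := fun y => γ (x - y))
      (by fun_prop))
    refine ENNReal.rpow_le_rpow ?_ hq0
    refine (enorm_fderiv_mollification_le hfg hφ hc x).trans (le_of_eq ?_)
    rw [hν, lintegral_withDensity_eq_lintegral_mul _ hφm (by fun_prop)]
    refine lintegral_congr_ae ?_
    have hx := (Measure.measurePreserving_sub_left volume x).quasiMeasurePreserving.ae_eq_comp hγ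
    filter_upwards [hx] with y hy
    simp only [Function.comp_apply] at hy
    simp [hy]
  calc _ ≤ ∫⁻ x, ∫⁻ y, γ (x - y) ^ q ∂ν := lintegral_mono hpt
    _ = ∫⁻ _, (∫⁻ x, γ x ^ q) ∂ν := by
        rw [lintegral_lintegral_swap (by fun_prop)]
        refine lintegral_congr fun y => ?_
        exact lintegral_sub_right_eq_self (fun x => γ x ^ q) y
    _ ≤ ∫⁻ x, γ x ^ q := by
        rw [lintegral_const]
        exact mul_le_of_le_one_right' hν1
    _ = _ := by
        refine lintegral_congr_ae ?_
        filter_upwards [hγ] with x hx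
        rw [hx]

theorem exists_contDiff_approximation {f : EuclideanSpace ℝ (Fin n) → ℝ}
    {g : EuclideanSpace ℝ (Fin n) → EuclideanSpace ℝ (Fin n)} (hfg : IsWeakGradient f g) :
    ∃ F : ℕ → EuclideanSpace ℝ (Fin n) → ℝ, (∀ k, ContDiff ℝ 1 (F k)) ∧
      (∀ᵐ x, Tendsto (fun k => F k x) atTop (𝓝 (f x))) ∧
      ∀ q : ℝ, 1 ≤ q → ∀ k, ∫⁻ x, ‖fderiv ℝ (F k) x‖ₑ ^ q ≤ ∫⁻ x, ‖g x‖ₑ ^ q := by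
  set Φ : ℕ → ContDiffBump (0 : EuclideanSpace ℝ (Fin n)) := fun k =>
    { rIn := 1 / ((k : ℝ) + 1)
      rOut := 2 * (1 / ((k : ℝ) + 1))
      rIn_pos := by positivity
      rIn_lt_rOut := by
        have : (0 : ℝ) < 1 / ((k : ℝ) + 1) := by positivity
        linarith } with hΦ
  have hout : Tendsto (fun k => (Φ k).rOut) atTop (𝓝 0) := by
    simpa [hΦ] using (tendsto_one_div_add_atTop_nhds_zero_nat (𝕜 := ℝ)).const_mul 2
  have hcd : ∀ k, ContDiff ℝ ∞ ((Φ k).normed (volume : Measure (EuclideanSpace ℝ (Fin n)))) :=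
    fun k => (Φ k).contDiff_normed
  refine ⟨fun k => (Φ k).normed volume ⋆[ContinuousLinearMap.lsmul ℝ ℝ, volume] f, ?_, ?_, ?_⟩
  · intro k
    exact (Φ k).hasCompactSupport_normed.contDiff_convolution_left _
      ((hcd k).of_le (by exact_mod_cast le_top)) hfg.locallyIntegrable_fun
  · exact ContDiffBump.ae_convolution_tendsto_right_of_locallyIntegrable hout
      (Eventually.of_forall fun k => le_refl (2 * (Φ k).rIn)) hfg.locallyIntegrable_fun
  · intro q hq k
    refine lintegral_enorm_fderiv_mollification_rpow_le hfg (hcd k)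
      (Φ k).hasCompactSupport_normed ?_ hq
    have h1 : ∀ y, ‖(Φ k).normed volume y‖ₑ = ENNReal.ofReal ((Φ k).normed volume y) :=
      fun y => Real.enorm_of_nonneg ((Φ k).nonneg_normed y)
    simp_rw [h1]
    rw [← ofReal_integral_eq_lintegral_ofReal (Φ k).integrable_normed
      (ae_of_all _ fun y => (Φ k).nonneg_normed y), (Φ k).integral_normed, ENNReal.ofReal_one]

/-- The embedding estimate for weakly differentiable functions. If the gradient is not in `L^n`, the
right-hand side is infinite. -/
theorem exists_besovNorm_le (hn : 2 ≤ n) {P : ℝ} (hP : n < P) :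
    ∃ C : ℝ, 0 < C ∧ ∀ p : ℝ, n < p → p ≤ P → ∀ (f : EuclideanSpace ℝ (Fin n) → ℝ)
      (g : EuclideanSpace ℝ (Fin n) → EuclideanSpace ℝ (Fin n)), IsWeakGradient f g →
      besovNorm (n / p) p n f ≤
        ENNReal.ofReal (C * (1 - n / p) ^ (-(1 / n : ℝ))) * eLpNorm g n volume := by
  obtain ⟨C, hC, hbound⟩ := exists_besovNorm_rpow_le_of_contDiff hn hP
  have hn0 : (0 : ℝ) < n := by positivity
  have hn1 : (1 : ℝ) ≤ n := by exact_mod_cast (by omega : 1 ≤ n)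
  refine ⟨C ^ (1 / n : ℝ), by positivity, fun p hnp hpP f g hfg => ?_⟩
  have hp0 : 0 < p := hn0.trans hnp
  have hα : 0 < 1 - n / p := by
    have : n / p < 1 := (div_lt_one hp0).2 hnp
    linarith
  obtain ⟨F, hF1, hF2, hF3⟩ := exists_contDiff_approximation hfg
  have h : besovNorm (n / p) p n f ^ (n : ℝ) ≤
      ENNReal.ofReal (C * (1 - n / p)⁻¹) * ∫⁻ x, ‖g x‖ₑ ^ (n : ℝ) := by
    refine besovNorm_rpow_le_of_tendsto (fun k => (hF1 k).continuous.measurable) hF2 hp0 hn0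
      fun k => (hbound p hnp hpP (F k) (hF1 k)).trans ?_
    exact mul_le_mul_right (hF3 n hn1 k) _
  have h2 : eLpNorm g n volume ^ (n : ℝ) = ∫⁻ x, ‖g x‖ₑ ^ (n : ℝ) := by
    rw [← eLpNorm_ofReal_rpow g hn0, ENNReal.ofReal_natCast]
  rw [← h2] at h
  have h3 := ENNReal.rpow_le_rpow h (by positivity : (0 : ℝ) ≤ 1 / n)
  rw [ENNReal.mul_rpow_of_nonneg _ _ (by positivity), ← ENNReal.rpow_mul, ← ENNReal.rpow_mul,
    mul_one_div_cancel hn0.ne', ENNReal.rpow_one, ENNReal.rpow_one,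
    ENNReal.ofReal_rpow_of_pos (by positivity), Real.mul_rpow hC.le (by positivity),
    Real.inv_rpow hα.le, ← Real.rpow_neg hα.le] at h3
  exact h3

end Mollification

/-! ### Sharpness of the blow-up rate -/

section LowerBound

variable {n : ℕ}

theorem continuous_gradient_of_contDiff {f : EuclideanSpace ℝ (Fin n) → ℝ} (hf : ContDiff ℝ 1 f) :
    Continuous (gradient f) :=
  (InnerProductSpace.toDual ℝ (EuclideanSpace ℝ (Fin n))).symm.continuous.comp
    (hf.continuous_fderiv one_ne_zero)

theorem hasCompactSupport_gradient {f : EuclideanSpace ℝ (Fin n) → ℝ}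
    (hc : HasCompactSupport f) : HasCompactSupport (gradient f) :=
  (hc.fderiv ℝ).comp_left
    (g := (InnerProductSpace.toDual ℝ (EuclideanSpace ℝ (Fin n))).symm) (map_zero _)

theorem isHomSobolevWithGradient_gradient (r : ℝ≥0∞) {f : EuclideanSpace ℝ (Fin n) → ℝ}
    (hf : ContDiff ℝ 1 f) (hc : HasCompactSupport f) :
    IsHomSobolevWithGradient r f (gradient f) := by
  have hgc := continuous_gradient_of_contDiff hf
  have hgs := hasCompactSupport_gradient hc
  refine ⟨⟨hf.continuous.locallyIntegrable, hgc.locallyIntegrable, ?_⟩,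
    hgc.memLp_of_hasCompactSupport hgs⟩
  intro φ hφ hφc v
  have hφ1 : ContDiff ℝ 1 φ := hφ.of_le (by exact_mod_cast le_top)
  have hφd : Continuous fun x => fderiv ℝ φ x v :=
    (hφ1.continuous_fderiv one_ne_zero).clm_apply continuous_const
  have hfd : Continuous fun x => fderiv ℝ f x v :=
    (hf.continuous_fderiv one_ne_zero).clm_apply continuous_const
  have h := integral_mul_fderiv_eq_neg_fderiv_mul_of_integrable (μ := volume) (f := f) (g := φ)
    (v := v) ((hfd.mul hφ1.continuous).integrable_of_hasCompactSupport hφc.mul_left)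
    ((hf.continuous.mul hφd).integrable_of_hasCompactSupport hc.mul_right)
    ((hf.continuous.mul hφ1.continuous).integrable_of_hasCompactSupport hc.mul_right)
    (fun x _ => hf.differentiable one_ne_zero x) (fun x _ => hφ1.differentiable one_ne_zero x)
  rw [h]
  congr 1
  refine integral_congr_ae (ae_of_all _ fun x => ?_)
  simp only
  rw [gradient, InnerProductSpace.toDual_symm_apply]

/-- The modulus of smoothness of a function that is linear with unit slope near the origin. -/
theorem exists_le_smoothnessModulus {f : EuclideanSpace ℝ (Fin n) → ℝ}
    {e : EuclideanSpace ℝ (Fin n)} (he : ‖e‖ = 1)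
    (hf : ∀ x ∈ Metric.ball (0 : EuclideanSpace ℝ (Fin n)) 1, f x = inner ℝ e x) :
    ∃ a : ℝ, 0 < a ∧ ∀ p t : ℝ, 1 ≤ p → 0 < t → t ≤ 1 / 2 →
      ENNReal.ofReal (a * t) ≤ smoothnessModulus f p t := by
  set m := volume (Metric.ball (0 : EuclideanSpace ℝ (Fin n)) (1 / 2)) with hm
  set b : ℝ≥0∞ := min 1 (ENNReal.ofReal ((1 / 4) ^ n) * m) with hb
  have hm0 : m ≠ 0 := (Metric.measure_ball_pos _ _ (by norm_num)).ne'
  have hb1 : b ≤ 1 := min_le_left _ _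
  have hbtop : b ≠ ⊤ := ne_top_of_le_ne_top ENNReal.one_ne_top hb1
  have hb0 : b ≠ 0 := by
    have : ENNReal.ofReal ((1 / 4) ^ n) * m ≠ 0 :=
      mul_ne_zero (ENNReal.ofReal_pos.2 (by positivity)).ne' hm0
    rw [hb]
    rcases min_choice 1 (ENNReal.ofReal ((1 / 4) ^ n) * m) with h | h
    · rw [h]; exact one_ne_zero
    · rw [h]; exact this
  refine ⟨b.toReal * (1 / 4), mul_pos (ENNReal.toReal_pos hb0 hbtop) (by norm_num), ?_⟩
  intro p t hp ht ht2
  have hp0 : 0 < p := by linarith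
  -- increments `h` in this ball satisfy `⟪e, h⟫ ≥ t / 4`
  set S := Metric.ball ((t / 2) • e) (t / 4) with hS
  have hSsub : S ⊆ Metric.ball 0 t := by
    intro h hh
    rw [hS, mem_ball_iff_norm] at hh
    rw [mem_ball_zero_iff]
    have h1 : ‖(t / 2) • e‖ = t / 2 := by
      rw [norm_smul, he, mul_one, Real.norm_of_nonneg (by positivity)]
    calc ‖h‖ = ‖(h - (t / 2) • e) + (t / 2) • e‖ := by simp
      _ ≤ ‖h - (t / 2) • e‖ + ‖(t / 2) • e‖ := norm_add_le _ _
      _ < t := by rw [h1]; linarith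
  have hslope : ∀ h ∈ S, t / 4 ≤ inner ℝ e h := by
    intro h hh
    rw [hS, mem_ball_iff_norm] at hh
    have h1 : inner ℝ e h = t / 2 + inner ℝ e (h - (t / 2) • e) := by
      rw [inner_sub_right, inner_smul_right, real_inner_self_eq_norm_sq, he]
      ring
    have h2 := abs_real_inner_le_norm e (h - (t / 2) • e)
    rw [he, one_mul] at h2
    have h3 := (abs_le.1 h2).1
    linarith
  have hinc : ∀ h ∈ S, ENNReal.ofReal (t / 4) ^ p * m ≤
      eLpNorm (fun x => f (x + h) - f x) (ENNReal.ofReal p) volume ^ p := by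
    intro h hh
    rw [eLpNorm_ofReal_rpow _ hp0, hm, ← setLIntegral_const]
    refine (setLIntegral_mono' Metric.isOpen_ball.measurableSet fun x hx => ?_).trans
      (setLIntegral_le_lintegral (Metric.ball 0 (1 / 2)) _)
    have hht := mem_ball_zero_iff.1 (hSsub hh)
    rw [mem_ball_zero_iff] at hx
    have hx1 : x ∈ Metric.ball (0 : EuclideanSpace ℝ (Fin n)) 1 :=
      mem_ball_zero_iff.2 (by linarith)
    have hx2 : x + h ∈ Metric.ball (0 : EuclideanSpace ℝ (Fin n)) 1 :=
      mem_ball_zero_iff.2 ((norm_add_le _ _).trans_lt (by linarith))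
    rw [hf _ hx1, hf _ hx2, inner_add_right, add_sub_cancel_left]
    have := hslope h hh
    rw [Real.enorm_of_nonneg (by linarith)]
    gcongr
  have hvol : volume S = ENNReal.ofReal ((1 / 4) ^ n) *
      volume (Metric.ball (0 : EuclideanSpace ℝ (Fin n)) t) := by
    rw [hS, Measure.addHaar_ball_center, volume_ball_euclideanSpace (by positivity),
      volume_ball_euclideanSpace ht, ← mul_assoc, ← ENNReal.ofReal_mul (by positivity), ← mul_pow]
    ring_nf
  have hint : ENNReal.ofReal (t / 4) ^ p * m * (ENNReal.ofReal ((1 / 4) ^ n) *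
      volume (Metric.ball (0 : EuclideanSpace ℝ (Fin n)) t)) ≤
      ∫⁻ h in Metric.ball (0 : EuclideanSpace ℝ (Fin n)) t,
      eLpNorm (fun x => f (x + h) - f x) (ENNReal.ofReal p) volume ^ p := by
    rw [← hvol, ← setLIntegral_const]
    exact (setLIntegral_mono' Metric.isOpen_ball.measurableSet hinc).trans
      (lintegral_mono_set hSsub)
  rw [smoothnessModulus, ← volume_ball_euclideanSpace ht]
  set w := volume (Metric.ball (0 : EuclideanSpace ℝ (Fin n)) t) with hw
  have hw0 : w ≠ 0 := (Metric.measure_ball_pos _ _ ht).ne'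
  have hwt : w ≠ ⊤ := measure_ball_lt_top.ne
  calc ENNReal.ofReal (b.toReal * (1 / 4) * t) = b * ENNReal.ofReal (t / 4) := by
        rw [show b.toReal * (1 / 4) * t = b.toReal * (t / 4) by ring,
          ENNReal.ofReal_mul ENNReal.toReal_nonneg, ENNReal.ofReal_toReal hbtop]
    _ ≤ b ^ (1 / p) * ENNReal.ofReal (t / 4) := by
        gcongr
        conv_lhs => rw [← ENNReal.rpow_one b]
        exact ENNReal.rpow_le_rpow_of_exponent_ge hb1 ((div_le_one hp0).2 hp)
    _ = (ENNReal.ofReal (t / 4) ^ p * b) ^ (1 / p) := by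
        rw [ENNReal.mul_rpow_of_nonneg _ _ (by positivity), ← ENNReal.rpow_mul,
          mul_one_div_cancel hp0.ne', ENNReal.rpow_one, mul_comm]
    _ ≤ (w⁻¹ * (ENNReal.ofReal (t / 4) ^ p * m * (ENNReal.ofReal ((1 / 4) ^ n) * w))) ^
          (1 / p) := by
        refine ENNReal.rpow_le_rpow ?_ (by positivity)
        calc ENNReal.ofReal (t / 4) ^ p * b
            ≤ ENNReal.ofReal (t / 4) ^ p * (ENNReal.ofReal ((1 / 4) ^ n) * m) := by
              gcongr
              exact min_le_right _ _
          _ = (w⁻¹ * w) * (ENNReal.ofReal (t / 4) ^ p * (ENNReal.ofReal ((1 / 4) ^ n) * m)) := by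
              rw [ENNReal.inv_mul_cancel hw0 hwt, one_mul]
          _ = _ := by ring
    _ ≤ _ := by gcongr

/-- For a function that is linear near the origin `ω(f, t)_p` is at least of order `t`, and
`∫_0^{1/2} t ^ (n (1 - n/p) - 1) dt` is of order `(1 - n/p)⁻¹`. -/
theorem exists_le_besovNorm (hn : n ≠ 0) {f : EuclideanSpace ℝ (Fin n) → ℝ}
    {e : EuclideanSpace ℝ (Fin n)} (he : ‖e‖ = 1)
    (hf : ∀ x ∈ Metric.ball (0 : EuclideanSpace ℝ (Fin n)) 1, f x = inner ℝ e x) :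
    ∃ c : ℝ, 0 < c ∧ ∀ p : ℝ, n < p →
      ENNReal.ofReal (c * (1 - n / p) ^ (-(1 / n : ℝ))) ≤ besovNorm (n / p) p n f := by
  obtain ⟨a, ha, hω⟩ := exists_le_smoothnessModulus he hf
  have hn0 : (0 : ℝ) < n := by positivity
  have hn1 : (1 : ℝ) ≤ n := by exact_mod_cast (by omega : 1 ≤ n)
  refine ⟨(a ^ n * ((1 / 2) ^ n / n)) ^ (1 / n : ℝ), by positivity, fun p hnp => ?_⟩
  have hp0 : 0 < p := hn0.trans hnp
  set α : ℝ := n / p with hα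
  have hα0 : 0 < α := by positivity
  have hα1 : 0 < 1 - α := by
    have : α < 1 := (div_lt_one hp0).2 hnp
    linarith
  have hpt : ∀ t ∈ Ioo (0 : ℝ) (1 / 2),
      ENNReal.ofReal (a ^ n) * ENNReal.ofReal (t ^ (n * (1 - α) - 1)) ≤
      ENNReal.ofReal (t ^ (-(α * n))) * smoothnessModulus f p t ^ (n : ℝ) *
        ENNReal.ofReal (1 / t) := by
    intro t ht
    have ht0 : 0 < t := ht.1
    have h1 := ENNReal.rpow_le_rpow (hω p t (by linarith) ht0 ht.2.le) hn0.le
    rw [ENNReal.ofReal_rpow_of_pos (by positivity), Real.rpow_natCast, mul_pow] at h1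
    refine le_trans (le_of_eq ?_) (mul_le_mul_left (mul_le_mul_right h1 _) _)
    rw [← ENNReal.ofReal_mul (by positivity), ← ENNReal.ofReal_mul (by positivity),
      ← ENNReal.ofReal_mul (by positivity)]
    congr 1
    have : t ^ (n * (1 - α) - 1) = t ^ (-(α * n)) * t ^ (n : ℝ) * t ^ (-1 : ℝ) := by
      rw [← Real.rpow_add ht0, ← Real.rpow_add ht0]
      ring_nf
    rw [this, Real.rpow_natCast, Real.rpow_neg_one, one_div]
    ring
  have hlow : ENNReal.ofReal (a ^ n * ((1 / 2) ^ n / n) * (1 - α)⁻¹) ≤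
      ∫⁻ t in Ioi (0 : ℝ), ENNReal.ofReal (t ^ (-(α * n))) * smoothnessModulus f p t ^ (n : ℝ) *
        ENNReal.ofReal (1 / t) := by
    calc _ ≤ ENNReal.ofReal (a ^ n) *
          ENNReal.ofReal ((1 / 2) ^ (n * (1 - α)) / (n * (1 - α))) := by
          rw [← ENNReal.ofReal_mul (by positivity), mul_assoc]
          have h1 : ((1 / 2 : ℝ)) ^ n ≤ (1 / 2) ^ (n * (1 - α)) := by
            rw [← Real.rpow_natCast]
            exact Real.rpow_le_rpow_of_exponent_ge (by norm_num) (by norm_num) (by nlinarith)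
          have h2 : ((1 / 2 : ℝ)) ^ n / n * (1 - α)⁻¹ = (1 / 2) ^ n / (n * (1 - α)) := by
            field_simp
          rw [h2]
          gcongr
      _ = ∫⁻ t in Ioo (0 : ℝ) (1 / 2),
            ENNReal.ofReal (a ^ n) * ENNReal.ofReal (t ^ (n * (1 - α) - 1)) := by
          rw [lintegral_const_mul' _ _ ENNReal.ofReal_ne_top,
            lintegral_Ioo_zero_rpow (by positivity) (by norm_num)]
      _ ≤ _ := (setLIntegral_mono' measurableSet_Ioo hpt).trans
          (lintegral_mono_set Ioo_subset_Ioi_self)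
  have h3 := ENNReal.rpow_le_rpow hlow (by positivity : (0 : ℝ) ≤ 1 / n)
  rw [ENNReal.ofReal_rpow_of_pos (by positivity), Real.mul_rpow (by positivity) (by positivity),
    Real.inv_rpow hα1.le, ← Real.rpow_neg hα1.le] at h3
  exact h3

theorem exists_contDiff_eq_inner (e : EuclideanSpace ℝ (Fin n)) :
    ∃ f : EuclideanSpace ℝ (Fin n) → ℝ, ContDiff ℝ 1 f ∧ HasCompactSupport f ∧
      ∀ x ∈ Metric.ball (0 : EuclideanSpace ℝ (Fin n)) 1, f x = inner ℝ e x := by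
  set B : ContDiffBump (0 : EuclideanSpace ℝ (Fin n)) := ⟨1, 2, one_pos, one_lt_two⟩ with hB
  refine ⟨fun x => B x * inner ℝ e x, B.contDiff.mul (contDiff_const.inner ℝ contDiff_id),
    B.hasCompactSupport.mul_right, fun x hx => ?_⟩
  show B x * inner ℝ e x = inner ℝ e x
  rw [B.one_of_mem_closedBall (Metric.ball_subset_closedBall hx), one_mul]

end LowerBound

theorem theorem4p2 (n : ℕ) (hn : 2 ≤ n) (p₀ : ℝ) :
    ∃ C c : ℝ, 0 < C ∧ 0 < c ∧ ∀ p : ℝ, (n : ℝ) < p → p < p₀ →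
      -- the embedding estimate
      (∀ (f : EuclideanSpace ℝ (Fin n) → ℝ)
          (g : EuclideanSpace ℝ (Fin n) → EuclideanSpace ℝ (Fin n)),
        IsHomSobolevWithGradient (n : ℝ≥0∞) f g →
          besovNorm ((n : ℝ) / p) p (n : ℝ) f ≤
            ENNReal.ofReal (C * (1 - (n : ℝ) / p) ^ (-(1 / (n : ℝ)))) *
              eLpNorm g (n : ℝ≥0∞) volume) ∧
      -- optimality: every admissible embedding constant blows up at least at this rate
      (∀ A : ℝ≥0,
        (∀ (f : EuclideanSpace ℝ (Fin n) → ℝ)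
            (g : EuclideanSpace ℝ (Fin n) → EuclideanSpace ℝ (Fin n)),
          IsHomSobolevWithGradient (n : ℝ≥0∞) f g →
            besovNorm ((n : ℝ) / p) p (n : ℝ) f ≤ (A : ℝ≥0∞) * eLpNorm g (n : ℝ≥0∞) volume) →
        c * (1 - (n : ℝ) / p) ^ (-(1 / (n : ℝ))) ≤ (A : ℝ)) := by
  obtain ⟨C, hC, hup⟩ := exists_besovNorm_le hn
    (lt_of_lt_of_le (lt_add_one (n : ℝ)) (le_max_right p₀ (n + 1)))
  set e : EuclideanSpace ℝ (Fin n) := EuclideanSpace.single ⟨0, by omega⟩ 1 with he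
  have he1 : ‖e‖ = 1 := by simp [he]
  obtain ⟨f, hf1, hfc, hfe⟩ := exists_contDiff_eq_inner e
  obtain ⟨c, hc, hlow⟩ := exists_le_besovNorm (by omega) he1 hfe
  have hsob := isHomSobolevWithGradient_gradient (n : ℝ≥0∞) hf1 hfc
  set D := (eLpNorm (gradient f) (n : ℝ≥0∞) volume).toReal with hD
  have hD0 : 0 ≤ D := ENNReal.toReal_nonneg
  refine ⟨C, c / (D + 1), hC, by positivity, fun p hnp hpp => ⟨fun f g hfg =>
    hup p hnp (hpp.le.trans (le_max_left _ _)) f g hfg.1, fun A hA => ?_⟩⟩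
  have hα : 0 < 1 - n / p := by
    have : n / p < 1 := (div_lt_one (lt_of_le_of_lt (by positivity) hnp)).2 hnp
    linarith
  have h := (hlow p hnp).trans (hA f _ hsob)
  rw [← ENNReal.ofReal_toReal hsob.2.eLpNorm_ne_top, ← hD, ← ENNReal.ofReal_coe_nnreal,
    ← ENNReal.ofReal_mul A.coe_nonneg, ENNReal.ofReal_le_ofReal_iff (by positivity)] at h
  rw [div_mul_eq_mul_div, div_le_iff₀ (by positivity)]
  nlinarith [A.coe_nonneg]
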